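/- Let $M$ be a smooth $m$-dimensional manifold without boundary (for instance a compact connected Riemannian manifold or $\mathbb R^m$), let $G\subseteq SU(N)$, and let $E\to M$ be a smooth vector bundle with fibre $\mathbb C^N$ and structure group $G$, given by local trivializations $\psi_a\colon E|_{W_a}\cong W_a\times\mathbb C^N$ over an open cover $(W_a)$ of $M$ with smooth $G$-valued transition functions $\psi_{ab}$, $\psi_a\psi_b^{-1}(x,\xi)=(x,\psi_{ab}(x)\xi)$. Let $A$ be a connection in $E$, that is, a family of smooth $\mathrm{Lie}(G)$-valued 1-forms $A^a=A^a_\mu dx^\mu$ on $W_a$ with $A^b=\psi_{ab}^{-1}A^a\psi_{ab}+\psi_{ab}^{-1}d\psi_{ab}$ on $W_a\cap W_b$. Its curvature $F$ is the $\mathrm{End}(E)$-valued 2-form given over $W_a$ by $F^a_{\mu\nu}=\partial_\mu A^a_\nu-\partial_\nu A^a_\mu+[A^a_\mu,A^a_\nu]$. Let $\Omega$ be the Hilbert manifold of $H^1$-curves $\gamma\colon[0,1]\to M$ (continuous curves that in every chart, on every compact subinterval mapped into its domain, are absolutely continuous with square integrable derivative). Its tangent space at $\gamma$ is the space $H^1_\gamma(TM)$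 of $H^1$ vector fields along $\gamma$. A map $p\mapsto\Gamma_p$ from a normed space to $\Omega$ is Fréchet differentiable at $p_0$, with derivative $p\mapsto X_p\in H^1_\gamma(TM)$, $\gamma=\Gamma_{p_0}$, if for every chart $\varphi$ of $M$ and every compact interval $I\subseteq[0,1]$ that $\gamma$ maps into the domain of $\varphi$, the curves $\Gamma_p$ with $p$ close to $p_0$ also map $I$ into this domain and $p\mapsto\varphi\circ\Gamma_p|_I\in H^1(I,\mathbb R^m)$ is Fréchet differentiable at $p_0$ with derivative $p\mapsto d\varphi(X_p)|_I$. A function $f$ on $\Omega$ with values in a finite-dimensional normed space has at $\gamma$ the first derivative $X\mapsto d_Xf(\gamma)$ if for every such $\Gamma$ with $\Gamma_{p_0}=\gamma$ the map $p\mapsto f(\Gamma_p)$ is Fréchet differentiable at $p_0$ with derivative $p\mapsto d_{X_p}f(\gamma)$. For $\gamma\in\Omega$ and $s,t\in[0,1]$ let $U_{t,s}(\gamma)\colon E_{\gamma(s)}\to E_{\gamma(t)}$ be the parallel transport generated by $A$: the multiplicative family ($U_{t,s}U_{s,r}=U_{t,r}$) whose matrix $U^a_{t,s}=\psi_aU_{t,s}\psi_a^{-1}$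 is, over any interval that $\gamma$ maps into $W_a$, an $H^1$ function of each of $t$ and $s$ satisfying almost everywhere $$\tfrac{d}{dt}U^a_{t,s}=-A^a_\mu(\gamma(t))\dot\gamma^\mu(t)U^a_{t,s},\qquad \tfrac{d}{ds}U^a_{t,s}=U^a_{t,s}A^a_\mu(\gamma(s))\dot\gamma^\mu(s),\qquad U^a_{s,s}=\mathrm{Id}.$$ Then such a parallel transport exists along every $\gamma\in\Omega$, and for all $\gamma\in\Omega$ and $0\le c\le d\le 1$ the following holds. In any local trivializations $\psi_a$ of $E$ near $\gamma(c)$ and $\psi_b$ near $\gamma(d)$, the parallel transport $U_{d,c}$, regarded as the matrix valued function $\sigma\mapsto\psi_bU_{d,c}(\sigma)\psi_a^{-1}$ of $\sigma\in\Omega$ near $\gamma$, has a first derivative at $\gamma$, given for $X\in H^1_\gamma(TM)$ by $$d_XU_{d,c}(\gamma)=-\int_c^dU_{d,t}(\gamma)F_{\mu\nu}(\gamma(t))X^\mu(t)\dot\gamma^\nu(t)U_{t,c}(\gamma)\,dt-A_\mu(\gamma(d))X^\mu(d)U_{d,c}(\gamma)+U_{d,c}(\gamma)A_\mu(\gamma(c))X^\mu(c),$$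 where all terms are expressed as matrices in these trivializations ($A=A^b$ at $\gamma(d)$ and $A=A^a$ at $\gamma(c)$), and the integrand is integrable on $[c,d]$ for every $X\in H^1_\gamma(TM)$. -/

import Mathlib

open Set Filter Topology MeasureTheory
open scoped Manifold ContDiff Matrix.Norms.L2Operator

noncomputable section

namespace CurveTransport

/-! ### The Sobolev class `H¹` on a compact interval -/

/-- `f ∈ H¹([a,b], V)`: absolutely continuous with square integrable derivative
(`V` is a finite dimensional normed space in all uses below). -/
def IsH1On {V : Type*} [NormedAddCommGroup V] [NormedSpace ℝ V] (a b : ℝ) (f : ℝ → V) : Prop :=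
  AbsolutelyContinuousOnInterval f a b ∧ MemLp (deriv f) 2 (volume.restrict (Icc a b))

/-- The Hilbert norm `(∫_a^b ‖f‖² + ∫_a^b ‖f'‖²)^{1/2}` of `f ∈ H¹([a,b], V)`. -/
def h1Norm {V : Type*} [NormedAddCommGroup V] [NormedSpace ℝ V] (a b : ℝ) (f : ℝ → V) : ℝ :=
  Real.sqrt ((∫ t in a..b, ‖f t‖ ^ 2) + ∫ t in a..b, ‖deriv f t‖ ^ 2)

section Curves

variable {d : ℕ} {M : Type*} [TopologicalSpace M] [ChartedSpace (EuclideanSpace ℝ (Fin d)) M]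

/-- The charts `(φ, W)` of the smooth manifold `M` (all charts of its smooth structure). -/
def charts (d : ℕ) (M : Type*) [TopologicalSpace M]
    [ChartedSpace (EuclideanSpace ℝ (Fin d)) M] :
    Set (OpenPartialHomeomorph M (EuclideanSpace ℝ (Fin d))) :=
  IsManifold.maximalAtlas (𝓡 d) ∞ M

/-- `H¹`-curves `[0,1] → M`: continuous, and of class `H¹` in every chart, on every compact
interval that the curve maps into the domain of the chart. Curves are written as functions on `ℝ`
of which only the values on `[0,1]` matter. -/
def IsH1Curve (d : ℕ) {M : Type*} [TopologicalSpace M]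
    [ChartedSpace (EuclideanSpace ℝ (Fin d)) M] (γ : ℝ → M) : Prop :=
  ContinuousOn γ (Icc 0 1) ∧
  ∀ φ ∈ charts d M, ∀ a b : ℝ, 0 ≤ a → a ≤ b → b ≤ 1 → MapsTo γ (Icc a b) φ.source →
    IsH1On a b (fun t => φ (γ t))

/-- The set `Ω` of all `H¹`-curves in `M`. -/
def CurveSpace (d : ℕ) (M : Type*) [TopologicalSpace M]
    [ChartedSpace (EuclideanSpace ℝ (Fin d)) M] : Type _ :=
  {γ : ℝ → M // IsH1Curve d γ}

/-- The velocity `γ̇(t) ∈ T_{γ(t)}M` (it exists for almost every `t ∈ [0,1]` when `γ ∈ Ω`). -/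
def velocity (d : ℕ) {M : Type*} [TopologicalSpace M]
    [ChartedSpace (EuclideanSpace ℝ (Fin d)) M] (γ : ℝ → M) (t : ℝ) : TangentSpace (𝓡 d) (γ t) :=
  mfderiv 𝓘(ℝ, ℝ) (𝓡 d) γ t (1 : ℝ)

/-- The coordinate expression `t ↦ (X^μ(t))_μ` in the chart `φ` of a vector field `X` along `γ`. -/
def fieldCoord (φ : OpenPartialHomeomorph M (EuclideanSpace ℝ (Fin d))) (γ : ℝ → M)
    (X : ∀ t : ℝ, TangentSpace (𝓡 d) (γ t)) (t : ℝ) : EuclideanSpace ℝ (Fin d) :=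
  mfderiv (𝓡 d) (𝓡 d) φ (γ t) (X t)

/-- `X ∈ H¹_γ(TM) = T_γ Ω`: the vector field `X` along `γ` is of class `H¹`. -/
def IsH1Field (γ : ℝ → M) (X : ∀ t : ℝ, TangentSpace (𝓡 d) (γ t)) : Prop :=
  ∀ φ ∈ charts d M, ∀ a b : ℝ, 0 ≤ a → a ≤ b → b ≤ 1 → MapsTo γ (Icc a b) φ.source →
    IsH1On a b (fieldCoord φ γ X)

/-- Fréchet differentiability of a map from a normed space into the Hilbert manifold `Ω`.
The map `Γ : P → Ω` with `Γ p₀ = γ` is differentiable at `p₀`, with derivative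
`P → T_γ Ω = H¹_γ(TM)`, `p ↦ X p`: whenever `γ` maps the interval `[a,b]` into the domain of a
chart `φ` of `M`, so do the nearby curves `Γ p`, and `p ↦ φ ∘ Γ p|_[a,b] ∈ H¹([a,b], ℝ^d)` is
Fréchet differentiable at `p₀` with derivative the bounded linear map
`p ↦ dφ(X p)|_[a,b]`. For `P = ℝ` this is a curve in `Ω` with tangent vector `X 1` at `γ`; for
`P = H¹_γ(TM)` and `X = id` the inverse charts `ξ ↦ exp_γ ξ` of `Ω` (defined for small `ξ`, and
continued by the constant `γ`) are of this kind. -/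
structure HasVariationAt {P : Type*} [NormedAddCommGroup P] [NormedSpace ℝ P]
    (γ : CurveSpace d M) (Γ : P → CurveSpace d M)
    (X : P →ₗ[ℝ] (∀ t : ℝ, TangentSpace (𝓡 d) (γ.1 t))) (p₀ : P) : Prop where
  base : Γ p₀ = γ
  tangent : ∀ p, IsH1Field γ.1 (X p)
  bounded : ∀ φ ∈ charts d M, ∀ a b : ℝ, 0 ≤ a → a ≤ b → b ≤ 1 →
    MapsTo γ.1 (Icc a b) φ.source →
    ∃ C : ℝ, ∀ p, h1Norm a b (fieldCoord φ γ.1 (X p)) ≤ C * ‖p‖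
  mapsTo : ∀ φ ∈ charts d M, ∀ a b : ℝ, 0 ≤ a → a ≤ b → b ≤ 1 →
    MapsTo γ.1 (Icc a b) φ.source →
    ∀ᶠ p in 𝓝 p₀, MapsTo (Γ p).1 (Icc a b) φ.source
  isLittleO : ∀ φ ∈ charts d M, ∀ a b : ℝ, 0 ≤ a → a ≤ b → b ≤ 1 →
    MapsTo γ.1 (Icc a b) φ.source →
    (fun p => h1Norm a b
      (fun t => φ ((Γ p).1 t) - φ (γ.1 t) - fieldCoord φ γ.1 (X (p - p₀)) t))
      =o[𝓝 p₀] (fun p => p - p₀)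

/-- The function `f` on (a neighbourhood of `γ` in) the Hilbert manifold `Ω` has at `γ` the first
derivative `X ↦ d_X f(γ) = L X`, `X ∈ T_γ Ω = H¹_γ(TM)`: along every map `Γ` from a normed space
into `Ω` which is Fréchet differentiable at `p₀` with `Γ p₀ = γ`, the composition `f ∘ Γ` is
Fréchet differentiable at `p₀`, and its derivative is given by the chain rule. With the inverse
chart `exp_γ` as `Γ` this contains Fréchet differentiability in the chart at `γ` (so `P : Type` is
no restriction: the model space `H¹_γ(TM)` lives there), and with `P = ℝ` it contains the
directional derivative along every differentiable curve in `Ω` with tangent vector `X`. -/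
def HasFirstDerivAt {V : Type*} [NormedAddCommGroup V] [NormedSpace ℝ V]
    (f : CurveSpace d M → V) (γ : CurveSpace d M)
    (L : (∀ t : ℝ, TangentSpace (𝓡 d) (γ.1 t)) → V) : Prop :=
  ∀ (P : Type) [NormedAddCommGroup P] [NormedSpace ℝ P] (Γ : P → CurveSpace d M)
    (X : P →ₗ[ℝ] (∀ t : ℝ, TangentSpace (𝓡 d) (γ.1 t))) (p₀ : P),
    HasVariationAt γ Γ X p₀ →
    ∃ D : P →L[ℝ] V, (∀ p, D p = L (X p)) ∧ HasFDerivAt (fun p => f (Γ p)) D p₀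

end Curves

/-! ### Vector bundles with structure group `G ⊆ SU(N)` and connections -/

/-- Complex `N × N` matrices, the endomorphisms of `ℂ^N`. -/
abbrev Mat (N : ℕ) : Type := Matrix (Fin N) (Fin N) ℂ

/-- The Lie algebra of `G ⊆ SU(N)`: the matrices whose one-parameter group lies in `G`. -/
def lieAlg {N : ℕ} (G : Subgroup (Matrix.specialUnitaryGroup (Fin N) ℂ)) : Set (Mat N) :=
  {B | ∀ s : ℝ, ∃ h ∈ G, (h : Mat N) = NormedSpace.exp (s • B)}

/-- The structure of a smooth vector bundle over `M` with fibre `ℂ^N` and structure group `G` on a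
family `E x`, `x ∈ M`, of complex vector spaces: local trivializations
`ψ_a : E x ≅ ℂ^N`, `x ∈ W_a`, over an open cover `(W_a)` of `M`, with smooth `G`-valued transition
functions `ψ_ab = ψ_a ψ_b⁻¹` on `W_a ∩ W_b`. Only the values of `ψ_a` over `W_a` matter. -/
structure GBundle (d : ℕ) {M : Type*} [TopologicalSpace M]
    [ChartedSpace (EuclideanSpace ℝ (Fin d)) M] {N : ℕ}
    (G : Subgroup (Matrix.specialUnitaryGroup (Fin N) ℂ))
    (E : M → Type*) [∀ x, AddCommGroup (E x)] [∀ x, Module ℂ (E x)] where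
  ι : Type*
  W : ι → Set M
  isOpen_W : ∀ a, IsOpen (W a)
  cover : ∀ x, ∃ a, x ∈ W a
  ψ : ι → ∀ x, E x ≃ₗ[ℂ] (Fin N → ℂ)
  transition_mem : ∀ a b, ∀ x ∈ W a ∩ W b, ∃ h ∈ G,
    (h : Mat N) = LinearMap.toMatrix' ((ψ a x).toLinearMap ∘ₗ (ψ b x).symm.toLinearMap)
  transition_smooth : ∀ a b, ContMDiffOn (𝓡 d) 𝓘(ℝ, Mat N) ∞
    (fun x => LinearMap.toMatrix' ((ψ a x).toLinearMap ∘ₗ (ψ b x).symm.toLinearMap))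
    (W a ∩ W b)

section Bundles

variable {d : ℕ} {M : Type*} [TopologicalSpace M] [ChartedSpace (EuclideanSpace ℝ (Fin d)) M]
  {N : ℕ} {G : Subgroup (Matrix.specialUnitaryGroup (Fin N) ℂ)}
  {E : M → Type*} [∀ x, AddCommGroup (E x)] [∀ x, Module ℂ (E x)]

/-- The transition function `ψ_ab`: `ψ_a (ψ_b⁻¹(x, ξ)) = (x, ψ_ab(x) ξ)`. -/
def GBundle.transition (B : GBundle d G E) (a b : B.ι) (x : M) : Mat N :=
  LinearMap.toMatrix' ((B.ψ a x).toLinearMap ∘ₗ (B.ψ b x).symm.toLinearMap)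

/-- The matrix `ψ_b T ψ_a⁻¹` of a linear map `T : E x → E y` in the trivializations `ψ_a` at `x`
and `ψ_b` at `y`. -/
def GBundle.matrixOf (B : GBundle d G E) (b a : B.ι) {y x : M} (T : E x →ₗ[ℂ] E y) : Mat N :=
  LinearMap.toMatrix' ((B.ψ b y).toLinearMap ∘ₗ T ∘ₗ (B.ψ a x).symm.toLinearMap)

/-- The expression of a matrix valued 1-form `θ` on `M` in the chart `φ`: the 1-form
`y ↦ (v ↦ θ_μ(y) v^μ)` on the target of the chart. -/
def formCoord (φ : OpenPartialHomeomorph M (EuclideanSpace ℝ (Fin d)))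
    (θ : ∀ x : M, TangentSpace (𝓡 d) x →L[ℝ] Mat N) (y : EuclideanSpace ℝ (Fin d)) :
    EuclideanSpace ℝ (Fin d) →L[ℝ] Mat N :=
  (θ (φ.symm y)).comp (mfderiv (𝓡 d) (𝓡 d) φ.symm y)

/-- A connection in the bundle: smooth `Lie(G)`-valued 1-forms `A^a` on the sets `W_a`, related by
`A^b = ψ_ab⁻¹ A^a ψ_ab + ψ_ab⁻¹ dψ_ab` on `W_a ∩ W_b`. Only the values of `A^a` over `W_a`
matter. -/
structure Connection (B : GBundle d G E) where
  A : B.ι → ∀ x : M, TangentSpace (𝓡 d) x →L[ℝ] Mat N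
  smooth : ∀ a, ∀ φ ∈ charts d M,
    ContDiffOn ℝ ∞ (formCoord φ (A a)) (φ.target ∩ φ.symm ⁻¹' B.W a)
  mem_lieAlg : ∀ a, ∀ x ∈ B.W a, ∀ v : TangentSpace (𝓡 d) x, A a x v ∈ lieAlg G
  compat : ∀ a b, ∀ x ∈ B.W a ∩ B.W b, ∀ v : TangentSpace (𝓡 d) x,
    A b x v = (B.transition a b x)⁻¹ * A a x v * B.transition a b x
      + (B.transition a b x)⁻¹ * mvfderiv (𝓡 d) (B.transition a b) x v

/-- The local curvature 2-form `F^a(x)(u, v) = F^a_{μν}(x) u^μ v^ν`, where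
`F^a_{μν} = ∂_μ A^a_ν - ∂_ν A^a_μ + [A^a_μ, A^a_ν]` in the preferred chart at `x`. -/
def Connection.localCurvature {B : GBundle d G E} (A : Connection B) (a : B.ι) (x : M)
    (u v : TangentSpace (𝓡 d) x) : Mat N :=
  let φ := chartAt (EuclideanSpace ℝ (Fin d)) x
  let u' : EuclideanSpace ℝ (Fin d) := mfderiv (𝓡 d) (𝓡 d) φ x u
  let v' : EuclideanSpace ℝ (Fin d) := mfderiv (𝓡 d) (𝓡 d) φ x v
  fderiv ℝ (formCoord φ (A.A a)) (φ x) u' v' - fderiv ℝ (formCoord φ (A.A a)) (φ x) v' u'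
    + (A.A a x u * A.A a x v - A.A a x v * A.A a x u)

/-- The curvature `F(x)(u, v) = F_{μν}(x) u^μ v^ν` as an endomorphism of the fibre `E x`:
`F(x) = ψ_a⁻¹ F^a(x) ψ_a` for (any) `a` with `x ∈ W_a`. -/
def Connection.curvature {B : GBundle d G E} (A : Connection B) (x : M)
    (u v : TangentSpace (𝓡 d) x) : E x →ₗ[ℂ] E x :=
  let a := (B.cover x).choose
  (B.ψ a x).symm.toLinearMap ∘ₗ Matrix.toLin' (A.localCurvature a x u v)
    ∘ₗ (B.ψ a x).toLinearMap

/-- `U t s : E_{γ(s)} → E_{γ(t)}`, `s, t ∈ [0,1]`, is the parallel transport along `γ` generated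
by the connection: it is multiplicative, and over each interval that `γ` maps into some `W_a` its
matrix `U^a_{t,s}` is an `H¹` solution of
`d/dt U^a_{t,s} = -A^a_μ(γ(t)) γ̇^μ(t) U^a_{t,s}`, `d/ds U^a_{t,s} = U^a_{t,s} A^a_μ(γ(s)) γ̇^μ(s)`,
`U^a_{s,s} = Id`. -/
structure Connection.IsParallelTransport {B : GBundle d G E} (A : Connection B) (γ : ℝ → M)
    (U : ∀ t s : ℝ, E (γ s) →ₗ[ℂ] E (γ t)) : Prop where
  comp : ∀ t ∈ Icc (0 : ℝ) 1, ∀ s ∈ Icc (0 : ℝ) 1, ∀ r ∈ Icc (0 : ℝ) 1,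
    U t s ∘ₗ U s r = U t r
  init : ∀ s ∈ Icc (0 : ℝ) 1, U s s = LinearMap.id
  deriv_fst : ∀ a : B.ι, ∀ s₀ t₀ : ℝ, 0 ≤ s₀ → s₀ ≤ t₀ → t₀ ≤ 1 →
    MapsTo γ (Icc s₀ t₀) (B.W a) → ∀ s ∈ Icc s₀ t₀,
    IsH1On s₀ t₀ (fun t => B.matrixOf a a (U t s)) ∧
    ∀ᵐ t ∂(volume.restrict (Icc s₀ t₀)), HasDerivAt (fun t => B.matrixOf a a (U t s))
      (-(A.A a (γ t) (velocity d γ t)) * B.matrixOf a a (U t s)) t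
  deriv_snd : ∀ a : B.ι, ∀ s₀ t₀ : ℝ, 0 ≤ s₀ → s₀ ≤ t₀ → t₀ ≤ 1 →
    MapsTo γ (Icc s₀ t₀) (B.W a) → ∀ t ∈ Icc s₀ t₀,
    IsH1On s₀ t₀ (fun s => B.matrixOf a a (U t s)) ∧
    ∀ᵐ s ∂(volume.restrict (Icc s₀ t₀)), HasDerivAt (fun s => B.matrixOf a a (U t s))
      (B.matrixOf a a (U t s) * A.A a (γ s) (velocity d γ s)) s

open Classical in
/-- The parallel transport `U_{t,s}(γ) : E_{γ(s)} → E_{γ(t)}` along `γ` generated by the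
connection (for `s, t ∈ [0,1]`, where it is unique). -/
def Connection.parallelTransport {B : GBundle d G E} (A : Connection B) (γ : ℝ → M) :
    ∀ t s : ℝ, E (γ s) →ₗ[ℂ] E (γ t) :=
  if h : ∃ U : ∀ t s : ℝ, E (γ s) →ₗ[ℂ] E (γ t), A.IsParallelTransport γ U then h.choose
  else fun _ _ => 0

end Bundles

end CurveTransport

end

/-!
Over an interval that the curve `y` maps into one chart and one trivialization, the transport
solves `Y' = -α(y) ẏ Y`. By variation of constants, perturbing the coefficient `α(y) ẏ` by `δ` to
first order changes `Y(e)` by `-Y(e) ∫ Y⁻¹ δ Y`, where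
`δ = (∂_ξ α)(y) ẏ + α(y) ξ̇` for a variation `ξ` of `y`. As
`d/dt (Y⁻¹ α(y)(ξ) Y) = Y⁻¹ (∂_ẏ α (ξ) + α(y)(ξ̇) + [α(ẏ), α(ξ)]) Y`, integrating by parts replaces
`δ` by the curvature `F(ξ, ẏ)` at the cost of two end-point terms.

The formula is compatible with gauge transformations, since `A` is covariant up to the derivative
of the transition function, and with concatenation: at a common end point of two intervals the
end-point terms cancel. A subdivision of `[c, e]` therefore reduces the theorem to the local case.
-/

noncomputable section

namespace CurveTransport

open scoped ENNReal

section AbsolutelyContinuous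

lemma absolutelyContinuousOnInterval_of_dist_le {X Y : Type*} [PseudoMetricSpace X]
    [PseudoMetricSpace Y] {f : ℝ → X} {g : ℝ → Y} {a b : ℝ} (K : ℝ)
    (hg : AbsolutelyContinuousOnInterval g a b)
    (hfg : ∀ x ∈ uIcc a b, ∀ y ∈ uIcc a b, dist (f x) (f y) ≤ K * dist (g x) (g y)) :
    AbsolutelyContinuousOnInterval f a b := by
  have hlim := Tendsto.const_mul K hg
  rw [mul_zero] at hlim
  refine squeeze_zero' (Eventually.of_forall fun E => Finset.sum_nonneg fun i _ => dist_nonneg)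
    ?_ hlim
  have hdisj : ∀ᶠ E in AbsolutelyContinuousOnInterval.totalLengthFilter ⊓
      𝓟 (AbsolutelyContinuousOnInterval.disjWithin a b),
      E ∈ AbsolutelyContinuousOnInterval.disjWithin a b :=
    mem_inf_of_right (mem_principal_self _)
  filter_upwards [hdisj] with E hE
  rw [Finset.mul_sum]
  exact Finset.sum_le_sum fun i hi => hfg _ (hE.1 i hi).1 _ (hE.1 i hi).2

lemma absolutelyContinuousOnInterval_prodMk {X Y : Type*} [PseudoMetricSpace X]
    [PseudoMetricSpace Y] {f : ℝ → X} {g : ℝ → Y} {a b : ℝ}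
    (hf : AbsolutelyContinuousOnInterval f a b) (hg : AbsolutelyContinuousOnInterval g a b) :
    AbsolutelyContinuousOnInterval (fun t => (f t, g t)) a b := by
  have hlim := Tendsto.add hf hg
  rw [add_zero] at hlim
  refine squeeze_zero (fun E => Finset.sum_nonneg fun i _ => dist_nonneg) (fun E => ?_) hlim
  rw [← Finset.sum_add_distrib]
  refine Finset.sum_le_sum fun i _ => ?_
  rw [Prod.dist_eq]
  exact max_le_add_of_nonneg dist_nonneg dist_nonneg

lemma absolutelyContinuousOnInterval_congr {X : Type*} [PseudoMetricSpace X] {f g : ℝ → X}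
    {a b : ℝ} (hf : AbsolutelyContinuousOnInterval f a b) (hfg : EqOn f g (uIcc a b)) :
    AbsolutelyContinuousOnInterval g a b :=
  absolutelyContinuousOnInterval_of_dist_le 1 hf fun x hx y hy => by
    rw [hfg hx, hfg hy, one_mul]

lemma absolutelyContinuousOnInterval_const {X : Type*} [PseudoMetricSpace X] (c : X) (a b : ℝ) :
    AbsolutelyContinuousOnInterval (fun _ => c) a b := by
  simpa [AbsolutelyContinuousOnInterval] using tendsto_const_nhds

variable {V W : Type*} [NormedAddCommGroup V] [NormedSpace ℝ V] [NormedAddCommGroup W]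
  [NormedSpace ℝ W] {a b : ℝ}

lemma absolutelyContinuousOnInterval_comp {f : ℝ → V} {F : V → W} {O : Set V}
    (hf : AbsolutelyContinuousOnInterval f a b) (hO : IsOpen O) (hF : ContDiffOn ℝ 1 F O)
    (hfO : MapsTo f (uIcc a b) O) : AbsolutelyContinuousOnInterval (fun t => F (f t)) a b := by
  have hcompact : IsCompact (f '' uIcc a b) := isCompact_uIcc.image_of_continuousOn hf.continuousOn
  have hloc : LocallyLipschitzOn (f '' uIcc a b) F := by
    rintro _ ⟨t, ht, rfl⟩
    obtain ⟨K, s, hs, hK⟩ := (hF.contDiffAt (hO.mem_nhds (hfO ht))).exists_lipschitzOnWith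
    exact ⟨K, s, mem_nhdsWithin_of_mem_nhds hs, hK⟩
  obtain ⟨K, hK⟩ := hloc.exists_lipschitzOnWith_of_compact hcompact
  exact absolutelyContinuousOnInterval_of_dist_le K hf fun x hx y hy =>
    hK.dist_le_mul _ (mem_image_of_mem _ hx) _ (mem_image_of_mem _ hy)

lemma absolutelyContinuousOnInterval_intervalIntegral {g : ℝ → V}
    (hg : IntervalIntegrable g volume a b) :
    AbsolutelyContinuousOnInterval (fun t => ∫ s in a..t, g s) a b := by
  refine absolutelyContinuousOnInterval_of_dist_le 1
    (hg.norm.absolutelyContinuousOnInterval_intervalIntegral (c := a) left_mem_uIcc) ?_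
  intro x hx y hy
  have hint : ∀ z ∈ uIcc a b, IntervalIntegrable g volume a z := fun z hz =>
    hg.mono_set (uIcc_subset_uIcc left_mem_uIcc hz)
  rw [dist_eq_norm, dist_eq_norm, one_mul, intervalIntegral.integral_interval_sub_left (hint x hx)
    (hint y hy), intervalIntegral.integral_interval_sub_left (hint x hx).norm (hint y hy).norm]
  exact intervalIntegral.norm_integral_le_abs_integral_norm

end AbsolutelyContinuous

section MemLp

variable {α F : Type*} [MeasurableSpace α] {μ : Measure α} [NormedAddCommGroup F] {p : ℝ≥0∞}

lemma memLp_restrict_union {g : α → F} {s t : Set α} (hs : MeasurableSet s) (ht : MeasurableSet t)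
    (hgs : MemLp g p (μ.restrict s)) (hgt : MemLp g p (μ.restrict t)) :
    MemLp g p (μ.restrict (s ∪ t)) := by
  have hgt' : MemLp g p (μ.restrict (t \ s)) :=
    hgt.mono_measure (Measure.restrict_mono sdiff_subset le_rfl)
  rw [← memLp_indicator_iff_restrict hs] at hgs
  rw [← memLp_indicator_iff_restrict (ht.diff hs)] at hgt'
  rw [← memLp_indicator_iff_restrict (hs.union ht), ← union_sdiff_self,
    indicator_union_of_disjoint disjoint_sdiff_right]
  exact hgs.add hgt'

variable {V W : Type*} [NormedAddCommGroup V] [NormedSpace ℝ V] [NormedAddCommGroup W]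
  [NormedSpace ℝ W] {a b : ℝ}

lemma memLp_clm_apply {c : ℝ → V →L[ℝ] W} {g : ℝ → V} (hc : ContinuousOn c (Icc a b))
    (hg : MemLp g p (volume.restrict (Icc a b))) :
    MemLp (fun t => c t (g t)) p (volume.restrict (Icc a b)) := by
  obtain ⟨C, hC⟩ := isCompact_Icc.exists_bound_of_continuousOn hc
  have hc' : MemLp c ∞ (volume.restrict (Icc a b)) :=
    memLp_top_of_bound (hc.aestronglyMeasurable_of_isCompact isCompact_Icc measurableSet_Icc) C
      ((ae_restrict_iff' measurableSet_Icc).2 (Eventually.of_forall hC))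
  exact (ContinuousLinearMap.id ℝ (V →L[ℝ] W)).memLp_of_bilin p hc' hg

lemma memLp_mul_of_continuousOn {𝔸 : Type*} [NormedRing 𝔸] [NormedAlgebra ℝ 𝔸] {g f : ℝ → 𝔸}
    (hg : MemLp g p (volume.restrict (Icc a b))) (hf : ContinuousOn f (Icc a b)) :
    MemLp (fun t => g t * f t) p (volume.restrict (Icc a b)) :=
  memLp_clm_apply (c := fun t => (ContinuousLinearMap.mul ℝ 𝔸).flip (f t))
    ((ContinuousLinearMap.mul ℝ 𝔸).flip.continuous.comp_continuousOn hf) hg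

lemma intervalIntegrable_iff_memLp_one {g : ℝ → F} (hab : a ≤ b) :
    IntervalIntegrable g volume a b ↔ MemLp g 1 (volume.restrict (Icc a b)) := by
  rw [intervalIntegrable_iff_integrableOn_Icc_of_le hab, IntegrableOn, memLp_one_iff_integrable]

end MemLp

lemma ae_mem_Ioo_of_mem_Icc (a b : ℝ) : ∀ᵐ t : ℝ, t ∈ Icc a b → t ∈ Ioo a b := by
  filter_upwards [(Ioo_ae_eq_Icc (μ := volume) (a := a) (b := b)).mem_iff] with t ht using ht.2

/-- `f` belongs to the Sobolev class `W^{1,p}([a,b], V)` and `f'` is its derivative: `f` is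
absolutely continuous, with almost everywhere derivative `f' ∈ L^p`. The case `p = 2` is `H¹`, the
case `p = 1` is absolute continuity with an integrable derivative. -/
structure HasLpDerivOn {V : Type*} [NormedAddCommGroup V] [NormedSpace ℝ V] (p : ℝ≥0∞) (a b : ℝ)
    (f f' : ℝ → V) : Prop where
  le : a ≤ b
  ac : AbsolutelyContinuousOnInterval f a b
  memLp : MemLp f' p (volume.restrict (Icc a b))
  ae_hasDerivAt : ∀ᵐ t, t ∈ Icc a b → HasDerivAt f (f' t) t

namespace HasLpDerivOn

variable {V W Z : Type*} [NormedAddCommGroup V] [NormedSpace ℝ V] [NormedAddCommGroup W]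
  [NormedSpace ℝ W] [NormedAddCommGroup Z] [NormedSpace ℝ Z] {p : ℝ≥0∞} {a b : ℝ}
  {f f' g g' : ℝ → V}

lemma continuousOn (h : HasLpDerivOn p a b f f') : ContinuousOn f (Icc a b) :=
  h.ac.continuousOn.mono Icc_subset_uIcc

lemma mono (h : HasLpDerivOn p a b f f') {s e : ℝ} (has : a ≤ s) (hse : s ≤ e) (heb : e ≤ b) :
    HasLpDerivOn p s e f f' where
  le := hse
  ac := h.ac.mono <| by
    rw [uIcc_of_le hse, uIcc_of_le h.le]; exact Icc_subset_Icc has heb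
  memLp := h.memLp.mono_measure (Measure.restrict_mono (Icc_subset_Icc has heb) le_rfl)
  ae_hasDerivAt := by
    filter_upwards [h.ae_hasDerivAt] with t ht hts using ht (Icc_subset_Icc has heb hts)

lemma congr_deriv (h : HasLpDerivOn p a b f f') (hfg : ∀ᵐ t, t ∈ Icc a b → f' t = g' t) :
    HasLpDerivOn p a b f g' where
  le := h.le
  ac := h.ac
  memLp := h.memLp.ae_eq ((ae_restrict_iff' measurableSet_Icc).2 hfg)
  ae_hasDerivAt := by
    filter_upwards [h.ae_hasDerivAt, hfg] with t hft hfgt ht using hfgt ht ▸ hft ht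

lemma congr (h : HasLpDerivOn p a b f f') (hfg : EqOn f g (Icc a b)) :
    HasLpDerivOn p a b g f' where
  le := h.le
  ac := absolutelyContinuousOnInterval_congr h.ac (by rwa [uIcc_of_le h.le])
  memLp := h.memLp
  ae_hasDerivAt := by
    filter_upwards [h.ae_hasDerivAt, ae_mem_Ioo_of_mem_Icc a b] with t hft htI ht
    refine (hft ht).congr_of_eventuallyEq ?_
    filter_upwards [isOpen_Ioo.mem_nhds (htI ht)] with s hs
    exact (hfg (Ioo_subset_Icc_self hs)).symm

lemma const (p : ℝ≥0∞) (hab : a ≤ b) (c : V) : HasLpDerivOn p a b (fun _ => c) (fun _ => 0) :=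
  ⟨hab, absolutelyContinuousOnInterval_const c a b, MemLp.zero,
    Eventually.of_forall fun t _ => hasDerivAt_const t c⟩

lemma sub (hf : HasLpDerivOn p a b f f') (hg : HasLpDerivOn p a b g g') :
    HasLpDerivOn p a b (fun t => f t - g t) (fun t => f' t - g' t) where
  le := hf.le
  ac := hf.ac.sub hg.ac
  memLp := hf.memLp.sub hg.memLp
  ae_hasDerivAt := by
    filter_upwards [hf.ae_hasDerivAt, hg.ae_hasDerivAt] with t hft hgt ht
      using (hft ht).sub (hgt ht)

lemma comp {O : Set V} {F : V → W} (h : HasLpDerivOn p a b f f') (hO : IsOpen O)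
    (hF : ContDiffOn ℝ 1 F O) (hfO : MapsTo f (Icc a b) O) :
    HasLpDerivOn p a b (fun t => F (f t)) (fun t => fderiv ℝ F (f t) (f' t)) where
  le := h.le
  ac := absolutelyContinuousOnInterval_comp h.ac hO hF (by rwa [uIcc_of_le h.le])
  memLp := memLp_clm_apply
    ((hF.continuousOn_fderiv_of_isOpen hO le_rfl).comp h.continuousOn hfO) h.memLp
  ae_hasDerivAt := by
    filter_upwards [h.ae_hasDerivAt] with t hft ht
    exact ((hF.differentiableOn one_ne_zero).differentiableAt
      (hO.mem_nhds (hfO ht))).hasFDerivAt.comp_hasDerivAt t (hft ht)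

lemma bilin {w w' : ℝ → W} (L : V →L[ℝ] W →L[ℝ] Z) (hf : HasLpDerivOn p a b f f')
    (hw : HasLpDerivOn p a b w w') :
    HasLpDerivOn p a b (fun t => L (f t) (w t)) (fun t => L (f t) (w' t) + L (f' t) (w t)) where
  le := hf.le
  ac := absolutelyContinuousOnInterval_comp (f := fun t => (f t, w t))
    (F := fun q => L q.1 q.2) (absolutelyContinuousOnInterval_prodMk hf.ac hw.ac) isOpen_univ
    L.isBoundedBilinearMap.contDiff.contDiffOn (mapsTo_univ _ _)
  memLp := by
    have hLf : ContinuousOn (fun t => L (f t)) (Icc a b) :=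
      L.continuous.comp_continuousOn hf.continuousOn
    have hLw : ContinuousOn (fun t => L.flip (w t)) (Icc a b) :=
      L.flip.continuous.comp_continuousOn hw.continuousOn
    have hfw : MemLp (fun t => L.flip (w t) (f' t)) p (volume.restrict (Icc a b)) :=
      memLp_clm_apply hLw hf.memLp
    exact (memLp_clm_apply hLf hw.memLp).add hfw
  ae_hasDerivAt := by
    filter_upwards [hf.ae_hasDerivAt, hw.ae_hasDerivAt] with t hft hwt ht
    exact L.hasDerivAt_of_bilinear (fun _ => hft ht) (fun _ => hwt ht)

lemma clm_apply {c c' : ℝ → V →L[ℝ] W} (hc : HasLpDerivOn p a b c c')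
    (hf : HasLpDerivOn p a b f f') :
    HasLpDerivOn p a b (fun t => c t (f t)) (fun t => c t (f' t) + c' t (f t)) :=
  hc.bilin (ContinuousLinearMap.id ℝ (V →L[ℝ] W)) hf

lemma mul {𝔸 : Type*} [NormedRing 𝔸] [NormedAlgebra ℝ 𝔸] {f f' g g' : ℝ → 𝔸}
    (hf : HasLpDerivOn p a b f f') (hg : HasLpDerivOn p a b g g') :
    HasLpDerivOn p a b (fun t => f t * g t) (fun t => f t * g' t + f' t * g t) :=
  hf.bilin (ContinuousLinearMap.mul ℝ 𝔸) hg

lemma mul_const {𝔸 : Type*} [NormedRing 𝔸] [NormedAlgebra ℝ 𝔸] {f f' : ℝ → 𝔸}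
    (hf : HasLpDerivOn p a b f f') (c : 𝔸) :
    HasLpDerivOn p a b (fun t => f t * c) (fun t => f' t * c) := by
  simpa only [mul_zero, zero_add] using hf.mul (const p hf.le c)

lemma const_mul {𝔸 : Type*} [NormedRing 𝔸] [NormedAlgebra ℝ 𝔸] {f f' : ℝ → 𝔸}
    (hf : HasLpDerivOn p a b f f') (c : 𝔸) :
    HasLpDerivOn p a b (fun t => c * f t) (fun t => c * f' t) := by
  simpa only [zero_mul, add_zero] using (const p hf.le c).mul hf

variable [Fact (1 ≤ p)]

lemma intervalIntegrable (h : HasLpDerivOn p a b f f') : IntervalIntegrable f' volume a b :=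
  (intervalIntegrable_iff_memLp_one h.le).2 (h.memLp.mono_exponent Fact.out)

variable [CompleteSpace V]

lemma integral_eq (h : HasLpDerivOn p a b f f') : ∫ t in a..b, f' t = f b - f a := by
  have hac : AbsolutelyContinuousOnInterval (fun x => f x - ∫ t in a..x, f' t) a b :=
    h.ac.sub (absolutelyContinuousOnInterval_intervalIntegral h.intervalIntegrable)
  have hderiv : ∀ᵐ x, x ∈ uIcc a b → HasDerivAt (fun x => f x - ∫ t in a..x, f' t) 0 x := by
    filter_upwards [h.ae_hasDerivAt, h.intervalIntegrable.ae_hasDerivAt_integral] with x hf hint hx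
    simpa only [sub_self] using
      (hf (by rwa [uIcc_of_le h.le] at hx)).fun_sub (hint hx a left_mem_uIcc)
  obtain ⟨C, hC⟩ := hac.const_of_ae_hasDerivAt_zero hderiv
  have ha : f a = C := by simpa using hC a left_mem_uIcc
  rw [ha, ← hC b right_mem_uIcc, sub_sub_cancel]

lemma of_integral (hab : a ≤ b) (hf' : MemLp f' p (volume.restrict (Icc a b)))
    (h : ∀ t ∈ Icc a b, f t = f a + ∫ s in a..t, f' s) : HasLpDerivOn p a b f f' := by
  have hint : IntervalIntegrable f' volume a b :=
    (intervalIntegrable_iff_memLp_one hab).2 (hf'.mono_exponent Fact.out)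
  have hprim : HasLpDerivOn p a b (fun t => f a + ∫ s in a..t, f' s) f' :=
    ⟨hab, (absolutelyContinuousOnInterval_const (f a) a b).add
      (absolutelyContinuousOnInterval_intervalIntegral hint), hf', by
      filter_upwards [hint.ae_hasDerivAt_integral] with t ht htI
      exact (ht (by rwa [uIcc_of_le hab]) a left_mem_uIcc).const_add (f a)⟩
  exact hprim.congr fun t ht => (h t ht).symm

lemma glue {m : ℝ} (h₁ : HasLpDerivOn p a m f f') (h₂ : HasLpDerivOn p m b f f') :
    HasLpDerivOn p a b f f' := by
  refine of_integral (h₁.le.trans h₂.le) ?_ fun t ht => ?_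
  · rw [← Icc_union_Icc_eq_Icc h₁.le h₂.le]
    exact memLp_restrict_union measurableSet_Icc measurableSet_Icc h₁.memLp h₂.memLp
  · rcases le_total t m with htm | hmt
    · rw [(h₁.mono le_rfl ht.1 htm).integral_eq, add_sub_cancel]
    · have h₂t := h₂.mono le_rfl hmt ht.2
      rw [← intervalIntegral.integral_add_adjacent_intervals h₁.intervalIntegrable
        h₂t.intervalIntegrable, h₁.integral_eq, h₂t.integral_eq]
      abel

lemma norm_sub_le_integral_norm (h : HasLpDerivOn p a b f f') {s t : ℝ} (hs : s ∈ Icc a b)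
    (ht : t ∈ Icc a b) : ‖f t - f s‖ ≤ ∫ x in a..b, ‖f' x‖ := by
  wlog hst : s ≤ t generalizing s t
  · rw [norm_sub_rev]; exact this ht hs (le_of_not_ge hst)
  have hfst := h.mono hs.1 hst ht.2
  calc ‖f t - f s‖ = ‖∫ x in s..t, f' x‖ := by rw [hfst.integral_eq]
    _ ≤ ∫ x in s..t, ‖f' x‖ := intervalIntegral.norm_integral_le_integral_norm hst
    _ ≤ ∫ x in a..b, ‖f' x‖ := intervalIntegral.integral_mono_interval hs.1 hst ht.2
        (Eventually.of_forall fun _ => norm_nonneg _) h.intervalIntegrable.norm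

end HasLpDerivOn

section Sobolev

variable {V : Type*} [NormedAddCommGroup V] [NormedSpace ℝ V] {a b : ℝ} {f f' : ℝ → V}

lemma HasLpDerivOn.isH1On (h : HasLpDerivOn 2 a b f f') : IsH1On a b f := by
  refine ⟨h.ac, h.memLp.ae_eq ((ae_restrict_iff' measurableSet_Icc).2 ?_)⟩
  filter_upwards [h.ae_hasDerivAt] with t hft ht using (hft ht).deriv.symm

lemma IsH1On.hasLpDerivOn (hab : a ≤ b) (h : IsH1On a b f)
    (hf' : ∀ᵐ t, t ∈ Icc a b → HasDerivAt f (f' t) t) : HasLpDerivOn 2 a b f f' := by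
  refine ⟨hab, h.1, h.2.ae_eq ((ae_restrict_iff' measurableSet_Icc).2 ?_), hf'⟩
  filter_upwards [hf'] with t hft ht using (hft ht).deriv

lemma IsH1On.hasLpDerivOn_deriv [FiniteDimensional ℝ V] (hab : a ≤ b) (h : IsH1On a b f) :
    HasLpDerivOn 2 a b f (deriv f) := by
  refine h.hasLpDerivOn hab ?_
  filter_upwards [h.1.boundedVariationOn.ae_differentiableAt_of_mem_uIcc] with t hft ht
  exact (hft (by rwa [uIcc_of_le hab])).hasDerivAt

lemma h1Norm_nonneg (a b : ℝ) (f : ℝ → V) : 0 ≤ h1Norm a b f := Real.sqrt_nonneg _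

lemma integral_norm_le_sqrt_mul_sqrt_integral {F : Type*} [NormedAddCommGroup F] {g : ℝ → F}
    (hab : a ≤ b) (hg : MemLp g 2 (volume.restrict (Icc a b))) :
    ∫ t in a..b, ‖g t‖ ≤ √(b - a) * √(∫ t in a..b, ‖g t‖ ^ 2) := by
  have hg' : MemLp (fun t => ‖g t‖) (ENNReal.ofReal 2) (volume.restrict (Ioc a b)) := by
    simpa using hg.norm.mono_measure (Measure.restrict_mono Ioc_subset_Icc_self le_rfl)
  have hcs := integral_mul_le_Lp_mul_Lq_of_nonneg (μ := volume.restrict (Ioc a b))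
    (p := 2) (q := 2) (Real.holderConjugate_iff.2 ⟨by norm_num, by norm_num⟩)
    (f := fun _ => (1 : ℝ)) (Eventually.of_forall fun _ => zero_le_one)
    (Eventually.of_forall fun t => norm_nonneg (g t)) (memLp_const 1) hg'
  have hone : ∫ _ in Ioc a b, (1 : ℝ) ^ (2 : ℝ) = b - a := by simp [hab]
  rw [hone] at hcs
  simpa only [← Real.sqrt_eq_rpow, one_mul, Real.rpow_two,
    ← intervalIntegral.integral_of_le hab] using hcs

lemma exists_norm_le_sqrt_integral {F : Type*} [NormedAddCommGroup F] {f : ℝ → F} (hab : a < b)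
    (hf : ContinuousOn f (Icc a b)) :
    ∃ s ∈ Icc a b, ‖f s‖ ≤ 1 / √(b - a) * √(∫ t in a..b, ‖f t‖ ^ 2) := by
  obtain ⟨s, hs, hmin⟩ := isCompact_Icc.exists_isMinOn (nonempty_Icc.2 hab.le) hf.norm
  refine ⟨s, hs, ?_⟩
  have hmean : (b - a) * ‖f s‖ ^ 2 ≤ ∫ t in a..b, ‖f t‖ ^ 2 := by
    have hmono : ∫ _ in a..b, ‖f s‖ ^ 2 ≤ ∫ t in a..b, ‖f t‖ ^ 2 := by
      refine intervalIntegral.integral_mono_on hab.le intervalIntegrable_const ?_ fun x hx =>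
        pow_le_pow_left₀ (norm_nonneg _) (hmin hx) 2
      exact ContinuousOn.intervalIntegrable (by rw [uIcc_of_le hab.le]; exact hf.norm.pow 2)
    simpa using hmono
  have hpos : 0 < b - a := sub_pos.2 hab
  rw [one_div, inv_mul_eq_div, le_div_iff₀ (Real.sqrt_pos.2 hpos), mul_comm]
  exact Real.le_sqrt_of_sq_le (by rwa [mul_pow, Real.sq_sqrt hpos.le])

/-- The constant of the embeddings of `H¹([a,b])` into `C([a,b])` and into `W^{1,1}([a,b])`. -/
def sobolevConst (a b : ℝ) : ℝ := 1 / √(b - a) + √(b - a)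

lemma sobolevConst_nonneg (a b : ℝ) : 0 ≤ sobolevConst a b := by
  unfold sobolevConst; positivity

lemma integral_norm_deriv_le_sqrt_mul_h1Norm (h : HasLpDerivOn 2 a b f f') :
    ∫ t in a..b, ‖f' t‖ ≤ √(b - a) * h1Norm a b f := by
  have hf' : ∫ t in a..b, ‖f' t‖ ^ 2 = ∫ t in a..b, ‖deriv f t‖ ^ 2 := by
    refine intervalIntegral.integral_congr_ae ?_
    filter_upwards [h.ae_hasDerivAt] with t hft ht
    rw [(hft (Ioc_subset_Icc_self (by rwa [uIoc_of_le h.le] at ht))).deriv]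
  have hf : 0 ≤ ∫ t in a..b, ‖f t‖ ^ 2 :=
    intervalIntegral.integral_nonneg h.le fun t _ => by positivity
  refine (integral_norm_le_sqrt_mul_sqrt_integral h.le h.memLp).trans ?_
  rw [hf', h1Norm]
  gcongr
  linarith

lemma integral_norm_deriv_le_h1Norm (h : HasLpDerivOn 2 a b f f') :
    ∫ t in a..b, ‖f' t‖ ≤ sobolevConst a b * h1Norm a b f := by
  refine (integral_norm_deriv_le_sqrt_mul_h1Norm h).trans ?_
  exact mul_le_mul_of_nonneg_right (le_add_of_nonneg_left (by positivity)) (h1Norm_nonneg a b f)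

lemma norm_le_h1Norm [CompleteSpace V] (hab : a < b) (h : HasLpDerivOn 2 a b f f') {t : ℝ}
    (ht : t ∈ Icc a b) : ‖f t‖ ≤ sobolevConst a b * h1Norm a b f := by
  obtain ⟨s, hs, hfs⟩ := exists_norm_le_sqrt_integral hab h.continuousOn
  have hdev : ‖f t - f s‖ ≤ √(b - a) * h1Norm a b f :=
    (h.norm_sub_le_integral_norm hs ht).trans (integral_norm_deriv_le_sqrt_mul_h1Norm h)
  have hderiv : 0 ≤ ∫ t in a..b, ‖deriv f t‖ ^ 2 :=
    intervalIntegral.integral_nonneg hab.le fun t _ => by positivity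
  have hmin : ‖f s‖ ≤ 1 / √(b - a) * h1Norm a b f := by
    refine hfs.trans (mul_le_mul_of_nonneg_left (Real.sqrt_le_sqrt ?_) (by positivity))
    linarith
  calc ‖f t‖ = ‖f s + (f t - f s)‖ := by rw [add_sub_cancel]
    _ ≤ 1 / √(b - a) * h1Norm a b f + √(b - a) * h1Norm a b f :=
        (norm_add_le _ _).trans (add_le_add hmin hdev)
    _ = sobolevConst a b * h1Norm a b f := by rw [sobolevConst, add_mul]

end Sobolev

lemma interval_induction {a b : ℝ} (hab : a ≤ b) {Q : ℝ → ℝ → Prop}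
    (hloc : ∀ t ∈ Icc a b, ∃ U : Set ℝ, IsOpen U ∧ t ∈ U ∧
      ∀ s e, a ≤ s → s ≤ e → e ≤ b → Icc s e ⊆ U → Q s e)
    (hglue : ∀ s m e, a ≤ s → s ≤ m → m ≤ e → e ≤ b → Q s m → Q m e → Q s e) : Q a b := by
  choose! U hU hmem hQ using hloc
  obtain ⟨t, ht₀, hmono, ⟨n, hn⟩, hcover⟩ := exists_monotone_Icc_subset_open_cover_Icc hab
    (c := fun i : Icc a b => Subtype.val ⁻¹' U i)
    (fun i => (hU i i.2).preimage continuous_subtype_val)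
    (fun x _ => mem_iUnion.2 ⟨x, hmem x x.2⟩)
  have hpiece : ∀ k, Q (t k) (t (k + 1)) := fun k => by
    obtain ⟨i, hi⟩ := hcover k
    refine hQ i i.2 _ _ (t k).2.1 (hmono k.le_succ) (t (k + 1)).2.2 fun x hx => ?_
    exact hi (show (⟨x, (t k).2.1.trans hx.1, hx.2.trans (t (k + 1)).2.2⟩ : Icc a b) ∈
      Icc (t k) (t (k + 1)) from ⟨hx.1, hx.2⟩)
  have hinitial : ∀ k, Q a (t (k + 1)) := fun k => by
    induction k with
    | zero => simpa only [ht₀] using hpiece 0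
    | succ k ih =>
      exact hglue _ _ _ le_rfl (t (k + 1)).2.1 (hmono (k + 1).le_succ) (t (k + 1 + 1)).2.2 ih
        (hpiece (k + 1))
  simpa only [hn (n + 1) n.le_succ] using hinitial n

/-! ### Linear equations with integrable coefficients -/

section LinearEquation

lemma intervalIntegrable_mul_of_continuousOn {R : Type*} [NormedRing R] {s e : ℝ} {k u : ℝ → R}
    (hse : s ≤ e) (hk : IntervalIntegrable k volume s e)
    (hu : ContinuousOn u (Icc s e)) {t : ℝ} (ht : t ∈ Icc s e) :
    IntervalIntegrable (fun τ => k τ * u τ) volume s t := by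
  rw [← uIcc_of_le hse] at hu ht
  exact (hk.mul_continuousOn hu).mono_set (uIcc_subset_uIcc left_mem_uIcc ht)

variable {𝔸 : Type*} [NormedRing 𝔸] [NormedAlgebra ℝ 𝔸] {s e : ℝ} {k u : ℝ → 𝔸}

lemma norm_integral_mul_le {C : ℝ} (hse : s ≤ e) (hk : IntervalIntegrable k volume s e)
    (hu : ∀ t ∈ Icc s e, ‖u t‖ ≤ C) {t : ℝ} (ht : t ∈ Icc s e) :
    ‖∫ τ in s..t, k τ * u τ‖ ≤ (∫ τ in s..e, ‖k τ‖) * C := by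
  have hC : 0 ≤ C := (norm_nonneg _).trans (hu t ht)
  calc ‖∫ τ in s..t, k τ * u τ‖ ≤ ∫ τ in s..t, ‖k τ‖ * C := by
        refine intervalIntegral.norm_integral_le_of_norm_le ht.1
          (Eventually.of_forall fun τ hτ => (norm_mul_le _ _).trans ?_) ?_
        · exact mul_le_mul_of_nonneg_left (hu τ ⟨hτ.1.le, hτ.2.trans ht.2⟩) (norm_nonneg _)
        · exact intervalIntegrable_mul_of_continuousOn hse hk.norm continuousOn_const ht
    _ = (∫ τ in s..t, ‖k τ‖) * C := intervalIntegral.integral_mul_const _ _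
    _ ≤ (∫ τ in s..e, ‖k τ‖) * C := by
        refine mul_le_mul_of_nonneg_right ?_ hC
        exact intervalIntegral.integral_mono_interval le_rfl ht.1 ht.2
          (Eventually.of_forall fun _ => norm_nonneg _) hk.norm

lemma norm_sub_one_le_of_integral_eq (hse : s ≤ e) (hk : IntervalIntegrable k volume s e)
    (hu : ContinuousOn u (Icc s e)) (hsol : ∀ t ∈ Icc s e, u t = 1 - ∫ τ in s..t, k τ * u τ)
    (hsmall : ∫ τ in s..e, ‖k τ‖ ≤ 1 / 2) {t : ℝ} (ht : t ∈ Icc s e) :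
    ‖u t - 1‖ ≤ (∫ τ in s..e, ‖k τ‖) * (2 * ‖(1 : 𝔸)‖) := by
  have hnonneg : 0 ≤ ∫ τ in s..e, ‖k τ‖ :=
    intervalIntegral.integral_nonneg hse fun _ _ => norm_nonneg _
  obtain ⟨t₀, ht₀, hmax⟩ := isCompact_Icc.exists_isMaxOn (nonempty_Icc.2 hse) hu.norm
  have hdev : ∀ t ∈ Icc s e, ‖u t - 1‖ ≤ (∫ τ in s..e, ‖k τ‖) * ‖u t₀‖ := fun t ht => by
    rw [hsol t ht, sub_sub_cancel_left, norm_neg]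
    exact norm_integral_mul_le hse hk (fun τ hτ => hmax hτ) ht
  have hsup : ‖u t₀‖ ≤ 2 * ‖(1 : 𝔸)‖ := by
    have htriangle : ‖u t₀‖ ≤ ‖(1 : 𝔸)‖ + ‖u t₀ - 1‖ := by
      simpa only [add_sub_cancel] using norm_add_le 1 (u t₀ - 1)
    nlinarith [hdev t₀ ht₀, norm_nonneg (u t₀)]
  exact (hdev t ht).trans (mul_le_mul_of_nonneg_left hsup hnonneg)

lemma norm_sub_linear_approx_le (hse : s ≤ e) (hk : IntervalIntegrable k volume s e)
    (hu : ContinuousOn u (Icc s e)) (hsol : ∀ t ∈ Icc s e, u t = 1 - ∫ τ in s..t, k τ * u τ)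
    (hsmall : ∫ τ in s..e, ‖k τ‖ ≤ 1 / 2) :
    ‖u e - 1 + ∫ τ in s..e, k τ‖ ≤ 2 * ‖(1 : 𝔸)‖ * (∫ τ in s..e, ‖k τ‖) ^ 2 := by
  have he : e ∈ Icc s e := right_mem_Icc.2 hse
  have hremainder : u e - 1 + ∫ τ in s..e, k τ = -∫ τ in s..e, k τ * (u τ - 1) := by
    simp only [mul_sub, mul_one]
    rw [intervalIntegral.integral_sub (intervalIntegrable_mul_of_continuousOn hse hk hu he) hk,
      hsol e he]
    abel
  calc ‖u e - 1 + ∫ τ in s..e, k τ‖ = ‖∫ τ in s..e, k τ * (u τ - 1)‖ := by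
        rw [hremainder, norm_neg]
    _ ≤ (∫ τ in s..e, ‖k τ‖) * ((∫ τ in s..e, ‖k τ‖) * (2 * ‖(1 : 𝔸)‖)) :=
        norm_integral_mul_le hse hk
          (fun t ht => norm_sub_one_le_of_integral_eq hse hk hu hsol hsmall ht) he
    _ = 2 * ‖(1 : 𝔸)‖ * (∫ τ in s..e, ‖k τ‖) ^ 2 := by ring

/-- The Picard operator `u ↦ 1 - ∫_s k u` on `C([s,e])`; its fixed points solve `u' = -k u`,
`u(s) = 1`. -/
def picardMap (hse : s ≤ e) (hk : IntervalIntegrable k volume s e) (u : C(Icc s e, 𝔸)) :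
    C(Icc s e, 𝔸) where
  toFun t := 1 - ∫ τ in s..t, k τ * IccExtend hse u τ
  continuous_toFun := by
    have hext : Continuous (IccExtend hse u) := u.continuous.Icc_extend'
    have hint : IntervalIntegrable (fun τ => k τ * IccExtend hse u τ) volume s e :=
      intervalIntegrable_mul_of_continuousOn hse hk hext.continuousOn (right_mem_Icc.2 hse)
    have hprim := intervalIntegral.continuousOn_primitive_interval' hint left_mem_uIcc
    rw [uIcc_of_le hse] at hprim
    exact continuous_const.sub (continuousOn_iff_continuous_domRestrict.1 hprim)

lemma dist_picardMap_le (hse : s ≤ e) (hk : IntervalIntegrable k volume s e)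
    (u v : C(Icc s e, 𝔸)) :
    dist (picardMap hse hk u) (picardMap hse hk v) ≤ (∫ τ in s..e, ‖k τ‖) * dist u v := by
  have hnonneg : 0 ≤ ∫ τ in s..e, ‖k τ‖ :=
    intervalIntegral.integral_nonneg hse fun _ _ => norm_nonneg _
  refine (ContinuousMap.dist_le (by positivity)).2 fun t => ?_
  have hint : ∀ w : C(Icc s e, 𝔸),
      IntervalIntegrable (fun τ => k τ * IccExtend hse w τ) volume s t := fun w =>
    intervalIntegrable_mul_of_continuousOn hse hk w.continuous.Icc_extend'.continuousOn t.2
  have hsub : picardMap hse hk u t - picardMap hse hk v t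
      = -∫ τ in s..t, k τ * (IccExtend hse u τ - IccExtend hse v τ) := by
    simp only [mul_sub]
    rw [intervalIntegral.integral_sub (hint u) (hint v)]
    simp only [picardMap, ContinuousMap.coe_mk]
    abel
  rw [dist_eq_norm, hsub, norm_neg]
  refine norm_integral_mul_le hse hk (fun τ _ => ?_) t.2
  rw [← dist_eq_norm]
  exact ContinuousMap.dist_apply_le_dist _

variable [CompleteSpace 𝔸]

lemma exists_integral_eq_of_integral_norm_lt_one (hse : s ≤ e)
    (hk : IntervalIntegrable k volume s e) (hsmall : ∫ τ in s..e, ‖k τ‖ < 1) :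
    ∃ u : ℝ → 𝔸, ContinuousOn u (Icc s e) ∧ ∀ t ∈ Icc s e, u t = 1 - ∫ τ in s..t, k τ * u τ := by
  have hnonneg : 0 ≤ ∫ τ in s..e, ‖k τ‖ :=
    intervalIntegral.integral_nonneg hse fun _ _ => norm_nonneg _
  have hcontracting : ContractingWith ⟨_, hnonneg⟩ (picardMap hse hk) :=
    ⟨hsmall, LipschitzWith.of_dist_le_mul (dist_picardMap_le hse hk)⟩
  let u := hcontracting.fixedPoint
  refine ⟨IccExtend hse u, u.continuous.Icc_extend'.continuousOn, fun t ht => ?_⟩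
  have hfix : picardMap hse hk u = u := hcontracting.fixedPoint_isFixedPt
  rw [IccExtend_of_mem hse _ ht]
  exact (DFunLike.congr_fun hfix ⟨t, ht⟩).symm

lemma exists_isUnit_linear_solution (hone : ‖(1 : 𝔸)‖ ≤ 1) {p : ℝ≥0∞} [Fact (1 ≤ p)] (hse : s ≤ e)
    (hk : MemLp k p (volume.restrict (Icc s e))) (hsmall : ∫ τ in s..e, ‖k τ‖ ≤ 1 / 4) :
    ∃ u : ℝ → 𝔸, HasLpDerivOn p s e u (fun t => -(k t * u t)) ∧ ∀ t ∈ Icc s e, IsUnit (u t) := by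
  have hk₁ : IntervalIntegrable k volume s e :=
    (intervalIntegrable_iff_memLp_one hse).2 (hk.mono_exponent Fact.out)
  obtain ⟨u, hu, hsol⟩ :=
    exists_integral_eq_of_integral_norm_lt_one hse hk₁ (hsmall.trans_lt (by norm_num))
  have hus : u s = 1 := by simpa using hsol s (left_mem_Icc.2 hse)
  refine ⟨u, HasLpDerivOn.of_integral hse (memLp_mul_of_continuousOn hk hu).neg fun t ht => ?_,
    fun t ht => ?_⟩
  · rw [hus, hsol t ht, intervalIntegral.integral_neg, sub_eq_add_neg]
  · have hdev := norm_sub_one_le_of_integral_eq hse hk₁ hu hsol (hsmall.trans (by norm_num)) ht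
    have hlt : ‖1 - u t‖ < 1 := by
      rw [norm_sub_rev]
      nlinarith [norm_nonneg (1 : 𝔸)]
    simpa only [sub_sub_cancel] using isUnit_one_sub_of_norm_lt_one hlt

end LinearEquation

/-! ### Solutions of linear equations as functions of their coefficient -/

section CurvatureForm

variable {V : Type*} [NormedAddCommGroup V] [NormedSpace ℝ V]
  {𝔸 : Type*} [NormedRing 𝔸] [NormedAlgebra ℝ 𝔸]

/-- The curvature `(dα + α ∧ α)(y)(u, v)` of an algebra valued 1-form on a vector space. -/
def curvForm (α : V → V →L[ℝ] 𝔸) (y u v : V) : 𝔸 :=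
  fderiv ℝ α y u v - fderiv ℝ α y v u + (α y u * α y v - α y v * α y u)

/-- `curvForm` as a bounded bilinear map. -/
def curvCLM (α : V → V →L[ℝ] 𝔸) (y : V) : V →L[ℝ] V →L[ℝ] 𝔸 :=
  fderiv ℝ α y - (fderiv ℝ α y).flip +
    ((((ContinuousLinearMap.mul ℝ 𝔸).comp (α y)).flip.comp (α y)).flip
      - (((ContinuousLinearMap.mul ℝ 𝔸).comp (α y)).flip.comp (α y)))

lemma curvCLM_apply (α : V → V →L[ℝ] 𝔸) (y u v : V) : curvCLM α y u v = curvForm α y u v := by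
  simp [curvCLM, curvForm]

lemma continuousOn_curvCLM {α : V → V →L[ℝ] 𝔸} {O : Set V} (hO : IsOpen O)
    (hα : ContDiffOn ℝ 1 α O) : ContinuousOn (curvCLM α) O := by
  have hderiv := hα.continuousOn_fderiv_of_isOpen hO le_rfl
  have hprod : ContinuousOn
      (fun y => ((ContinuousLinearMap.mul ℝ 𝔸).comp (α y)).flip.comp (α y)) O :=
    ((ContinuousLinearMap.flipₗᵢ ℝ V 𝔸 𝔸).continuous.comp_continuousOn
      (continuousOn_const.clm_comp hα.continuousOn)).clm_comp hα.continuousOn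
  exact (hderiv.sub
    ((ContinuousLinearMap.flipₗᵢ ℝ V V 𝔸).continuous.comp_continuousOn hderiv)).add
      (((ContinuousLinearMap.flipₗᵢ ℝ V V 𝔸).continuous.comp_continuousOn hprod).sub hprod)

lemma memLp_curvForm {α : V → V →L[ℝ] 𝔸} {O : Set V} {p : ℝ≥0∞} {s e : ℝ} {x x' ξ : ℝ → V}
    (hO : IsOpen O) (hα : ContDiffOn ℝ 1 α O) (hx : HasLpDerivOn p s e x x')
    (hxO : MapsTo x (Icc s e) O) (hξ : ContinuousOn ξ (Icc s e)) :
    MemLp (fun t => curvForm α (x t) (ξ t) (x' t)) p (volume.restrict (Icc s e)) := by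
  have hcoeff : ContinuousOn (fun t => curvCLM α (x t) (ξ t)) (Icc s e) :=
    ((continuousOn_curvCLM hO hα).comp hx.continuousOn hxO).clm_apply hξ
  simpa only [curvCLM_apply] using memLp_clm_apply hcoeff hx.memLp

end CurvatureForm

section Taylor

variable {V F : Type*} [NormedAddCommGroup V] [NormedSpace ℝ V] [NormedAddCommGroup F]
  [NormedSpace ℝ F] {O K : Set V} {f : V → F}

lemma eventually_norm_taylor_le_nhds (hO : IsOpen O) (hf : ContDiffOn ℝ 1 f O) {x₀ : V}
    (hx₀ : x₀ ∈ O) {ε : ℝ} (hε : 0 < ε) :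
    ∀ᶠ q : V × V in 𝓝 (x₀, x₀), q.1 ∈ O ∧
      ‖f q.1 - f q.2 - fderiv ℝ f q.2 (q.1 - q.2)‖ ≤ ε * ‖q.1 - q.2‖ := by
  have hOx : O ∈ 𝓝 x₀ := hO.mem_nhds hx₀
  have hstrict := ((hf.contDiffAt hOx).hasStrictFDerivAt one_ne_zero).isLittleO.def (half_pos hε)
  have hderiv : ∀ᶠ x in 𝓝 x₀, dist (fderiv ℝ f x) (fderiv ℝ f x₀) < ε / 2 :=
    Metric.tendsto_nhds.1 ((hf.continuousOn_fderiv_of_isOpen hO le_rfl).continuousAt hOx) _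
      (half_pos hε)
  filter_upwards [hstrict, continuous_snd.tendsto (x₀, x₀) |>.eventually hderiv,
    continuous_fst.tendsto (x₀, x₀) |>.eventually_mem hOx] with q hq hq' hqO
  refine ⟨hqO, ?_⟩
  have hchange : ‖(fderiv ℝ f q.2 - fderiv ℝ f x₀) (q.1 - q.2)‖ ≤ ε / 2 * ‖q.1 - q.2‖ :=
    ContinuousLinearMap.le_of_opNorm_le _ (by rw [← dist_eq_norm]; exact hq'.le) _
  calc ‖f q.1 - f q.2 - fderiv ℝ f q.2 (q.1 - q.2)‖
      = ‖(f q.1 - f q.2 - fderiv ℝ f x₀ (q.1 - q.2))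
          - (fderiv ℝ f q.2 - fderiv ℝ f x₀) (q.1 - q.2)‖ := by rw [sub_apply]; abel_nf
    _ ≤ ε / 2 * ‖q.1 - q.2‖ + ε / 2 * ‖q.1 - q.2‖ := norm_sub_le_of_le hq hchange
    _ = ε * ‖q.1 - q.2‖ := by ring

lemma exists_norm_taylor_le_of_isCompact (hO : IsOpen O) (hf : ContDiffOn ℝ 1 f O)
    (hK : IsCompact K) (hKO : K ⊆ O) {ε : ℝ} (hε : 0 < ε) :
    ∃ ρ > 0, ∀ x ∈ K, ∀ y, ‖y - x‖ < ρ →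
      y ∈ O ∧ ‖f y - f x - fderiv ℝ f x (y - x)‖ ≤ ε * ‖y - x‖ := by
  have huniform : ∀ᶠ h in 𝓝 (0 : V), ∀ x ∈ K, x + h ∈ O ∧
      ‖f (x + h) - f x - fderiv ℝ f x (x + h - x)‖ ≤ ε * ‖x + h - x‖ := by
    refine hK.eventually_forall_of_forall_eventually fun x₀ hx₀ => ?_
    have hlim : Tendsto (fun q : V × V => (q.2 + q.1, q.2)) (𝓝 (0, x₀)) (𝓝 (x₀, x₀)) := by
      simpa using Continuous.tendsto (f := fun q : V × V => (q.2 + q.1, q.2)) (by fun_prop) (0, x₀)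
    exact hlim.eventually (eventually_norm_taylor_le_nhds hO hf (hKO hx₀) hε)
  obtain ⟨ρ, hρ, h⟩ := Metric.eventually_nhds_iff.1 huniform
  refine ⟨ρ, hρ, fun x hx y hy => ?_⟩
  simpa only [add_sub_cancel] using h (y := y - x) (by simpa using hy) x hx

end Taylor

section Coefficient

lemma integral_norm_le_of_norm_le {F : Type*} [NormedAddCommGroup F] {s e : ℝ}
    {f : ℝ → F} {g : ℝ → ℝ} (hse : s ≤ e) (hfg : ∀ t ∈ Icc s e, ‖f t‖ ≤ g t)
    (hg : IntervalIntegrable g volume s e) : ∫ t in s..e, ‖f t‖ ≤ ∫ t in s..e, g t :=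
  (le_abs_self _).trans <| intervalIntegral.norm_integral_le_of_norm_le hse
    (Eventually.of_forall fun t ht =>
      (norm_norm (f t)).trans_le (hfg t (Ioc_subset_Icc_self ht))) hg

variable {V : Type*} [NormedAddCommGroup V] [NormedSpace ℝ V]
  {F : Type*} [NormedAddCommGroup F] [NormedSpace ℝ F]

lemma norm_coeff_sub_le (α β : V →L[ℝ] F) (A : V →L[ℝ] V →L[ℝ] F) (w ξ x' y' ξ' : V) :
    ‖β y' - α x' - (A ξ x' + α ξ')‖ ≤ (‖β - α - A w‖ + ‖A‖ * ‖w - ξ‖) * ‖x'‖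
      + ‖β - α‖ * ‖y' - x'‖ + ‖α‖ * ‖y' - x' - ξ'‖ := by
  have hsplit : β y' - α x' - (A ξ x' + α ξ')
      = ((β - α - A w) x' + A (w - ξ) x') + (β - α) (y' - x') + α (y' - x' - ξ') := by
    simp only [map_sub, sub_apply]
    abel
  rw [hsplit, add_mul]
  refine norm_add_le_of_le (norm_add_le_of_le (norm_add_le_of_le ?_ ?_) ?_) ?_
  · exact ContinuousLinearMap.le_opNorm _ _
  · exact A.le_opNorm₂ _ _
  · exact ContinuousLinearMap.le_opNorm _ _
  · exact ContinuousLinearMap.le_opNorm _ _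

lemma integral_norm_coeff_sub_le {s e L D r : ℝ} (hse : s ≤ e) {α β : ℝ → V →L[ℝ] F}
    {A : ℝ → V →L[ℝ] V →L[ℝ] F} {w ξ x' y' ξ' : ℝ → V}
    (hx' : IntervalIntegrable x' volume s e) (hy' : IntervalIntegrable y' volume s e)
    (hξ' : IntervalIntegrable ξ' volume s e)
    (hα : ∀ t ∈ Icc s e, ‖α t‖ ≤ L) (hA : ∀ t ∈ Icc s e, ‖A t‖ ≤ L)
    (hβ : ∀ t ∈ Icc s e, ‖β t - α t‖ ≤ D) (htaylor : ∀ t ∈ Icc s e, ‖β t - α t - A t (w t)‖ ≤ r)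
    (hw : ∀ t ∈ Icc s e, ‖w t - ξ t‖ ≤ r) :
    ∫ t in s..e, ‖β t (y' t) - α t (x' t) - (A t (ξ t) (x' t) + α t (ξ' t))‖
      ≤ (r + L * r) * (∫ t in s..e, ‖x' t‖) + D * (∫ t in s..e, ‖y' t - x' t‖)
        + L * ∫ t in s..e, ‖y' t - x' t - ξ' t‖ := by
  have hL : 0 ≤ L := (norm_nonneg _).trans (hα s (left_mem_Icc.2 hse))
  have hint₁ := hx'.norm.const_mul (r + L * r)
  have hint₂ := (hy'.sub hx').norm.const_mul D
  have hint₃ := ((hy'.sub hx').sub hξ').norm.const_mul L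
  rw [← intervalIntegral.integral_const_mul, ← intervalIntegral.integral_const_mul,
    ← intervalIntegral.integral_const_mul, ← intervalIntegral.integral_add hint₁ hint₂,
    ← intervalIntegral.integral_add (hint₁.add hint₂) hint₃]
  refine integral_norm_le_of_norm_le hse (fun t ht => ?_) ((hint₁.add hint₂).add hint₃)
  refine (norm_coeff_sub_le (α t) (β t) (A t) (w t) (ξ t) (x' t) (y' t) (ξ' t)).trans ?_
  gcongr
  · exact htaylor t ht
  · exact hA t ht
  · exact hw t ht
  · exact hβ t ht
  · exact hα t ht

end Coefficient

section Variation

lemma intervalIntegrable_mul_mul {R : Type*} [NormedRing R] {s e : ℝ} {W g Z : ℝ → R}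
    (hse : s ≤ e) (hW : ContinuousOn W (Icc s e)) (hZ : ContinuousOn Z (Icc s e))
    (hg : IntervalIntegrable g volume s e) :
    IntervalIntegrable (fun t => W t * g t * Z t) volume s e := by
  rw [← uIcc_of_le hse] at hW hZ
  exact (hg.continuousOn_mul hW).mul_continuousOn hZ

lemma integral_norm_mul_mul_le {R : Type*} [NormedRing R] {s e κ : ℝ} {W g Z : ℝ → R}
    (hse : s ≤ e) (hg : IntervalIntegrable g volume s e) (hWκ : ∀ t ∈ Icc s e, ‖W t‖ ≤ κ)
    (hZκ : ∀ t ∈ Icc s e, ‖Z t‖ ≤ κ) :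
    ∫ t in s..e, ‖W t * g t * Z t‖ ≤ κ ^ 2 * ∫ t in s..e, ‖g t‖ := by
  have hκ : 0 ≤ κ := (norm_nonneg _).trans (hWκ s (left_mem_Icc.2 hse))
  rw [← intervalIntegral.integral_const_mul]
  refine integral_norm_le_of_norm_le hse (fun t ht => ?_) (hg.norm.const_mul _)
  calc ‖W t * g t * Z t‖ ≤ ‖W t‖ * ‖g t‖ * ‖Z t‖ :=
        (norm_mul_le _ _).trans (mul_le_mul_of_nonneg_right (norm_mul_le _ _) (norm_nonneg _))
    _ ≤ κ * ‖g t‖ * κ := by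
        gcongr
        · exact hWκ t ht
        · exact hZκ t ht
    _ = κ ^ 2 * ‖g t‖ := by ring

variable {𝔸 : Type*} [NormedRing 𝔸] [NormedAlgebra ℝ 𝔸] [CompleteSpace 𝔸] {p : ℝ≥0∞}
  [Fact (1 ≤ p)] {s e : ℝ} {W Z Y a b δ : ℝ → 𝔸}

lemma mul_solution_eq_one_sub_integral (hW : HasLpDerivOn p s e W (fun t => W t * a t))
    (hY : HasLpDerivOn p s e Y (fun t => -(b t * Y t))) (hWs : W s = 1) (hYs : Y s = 1)
    (hZW : ∀ t ∈ Icc s e, Z t * W t = 1) {t : ℝ} (ht : t ∈ Icc s e) :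
    W t * Y t = 1 - ∫ τ in s..t, W τ * (b τ - a τ) * Z τ * (W τ * Y τ) := by
  have hprod := ((hW.mul hY).mono le_rfl ht.1 ht.2).integral_eq
  rw [hWs, hYs, one_mul] at hprod
  have hcongr : ∫ τ in s..t, W τ * (b τ - a τ) * Z τ * (W τ * Y τ)
      = ∫ τ in s..t, -(W τ * -(b τ * Y τ) + W τ * a τ * Y τ) := by
    refine intervalIntegral.integral_congr fun τ hτ => ?_
    rw [uIcc_of_le ht.1] at hτ
    calc W τ * (b τ - a τ) * Z τ * (W τ * Y τ) = W τ * (b τ - a τ) * (Z τ * W τ) * Y τ := by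
          simp only [mul_assoc]
      _ = -(W τ * -(b τ * Y τ) + W τ * a τ * Y τ) := by
          rw [hZW τ ⟨hτ.1, hτ.2.trans ht.2⟩]
          noncomm_ring
  rw [hcongr, intervalIntegral.integral_neg, hprod]
  abel

lemma norm_solution_sub_variation_le {κ : ℝ} (hW : HasLpDerivOn p s e W (fun t => W t * a t))
    (hZ : ContinuousOn Z (Icc s e)) (hZW : ∀ t ∈ Icc s e, Z t * W t = 1)
    (hY : HasLpDerivOn p s e Y (fun t => -(b t * Y t))) (hWs : W s = 1) (hYs : Y s = 1)
    (ha : IntervalIntegrable a volume s e) (hb : IntervalIntegrable b volume s e)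
    (hδ : IntervalIntegrable δ volume s e) (hWκ : ∀ t ∈ Icc s e, ‖W t‖ ≤ κ)
    (hZκ : ∀ t ∈ Icc s e, ‖Z t‖ ≤ κ) (hsmall : κ ^ 2 * (∫ t in s..e, ‖b t - a t‖) ≤ 1 / 2) :
    ‖W e * Y e - 1 + ∫ t in s..e, W t * δ t * Z t‖
      ≤ 2 * ‖(1 : 𝔸)‖ * (κ ^ 2 * ∫ t in s..e, ‖b t - a t‖) ^ 2
        + κ ^ 2 * ∫ t in s..e, ‖b t - a t - δ t‖ := by
  have hse := hW.le
  have hcoeff := integral_norm_mul_mul_le hse (hb.sub ha) hWκ hZκ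
  have hint : ∀ {g : ℝ → 𝔸}, IntervalIntegrable g volume s e →
      IntervalIntegrable (fun t => W t * g t * Z t) volume s e :=
    intervalIntegrable_mul_mul hse hW.continuousOn hZ
  have hlinear := norm_sub_linear_approx_le hse (hint (hb.sub ha))
    (hW.continuousOn.mul hY.continuousOn)
    (fun t ht => mul_solution_eq_one_sub_integral hW hY hWs hYs hZW ht) (hcoeff.trans hsmall)
  have hremainder : ∫ t in s..e, W t * (b t - a t - δ t) * Z t
      = (∫ t in s..e, W t * (b t - a t) * Z t) - ∫ t in s..e, W t * δ t * Z t := by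
    simp only [mul_sub _ (_ - _), sub_mul _ (W _ * δ _)]
    exact intervalIntegral.integral_sub (hint (hb.sub ha)) (hint hδ)
  calc ‖W e * Y e - 1 + ∫ t in s..e, W t * δ t * Z t‖
      = ‖(W e * Y e - 1 + ∫ t in s..e, W t * (b t - a t) * Z t)
          - ∫ t in s..e, W t * (b t - a t - δ t) * Z t‖ := by rw [hremainder]; abel_nf
    _ ≤ 2 * ‖(1 : 𝔸)‖ * (∫ t in s..e, ‖W t * (b t - a t) * Z t‖) ^ 2
          + ∫ t in s..e, ‖W t * (b t - a t - δ t) * Z t‖ :=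
        norm_sub_le_of_le hlinear (intervalIntegral.norm_integral_le_integral_norm hse)
    _ ≤ _ := by
        have hnonneg : 0 ≤ ∫ t in s..e, ‖W t * (b t - a t) * Z t‖ :=
          intervalIntegral.integral_nonneg hse fun _ _ => norm_nonneg _
        gcongr
        exact integral_norm_mul_mul_le hse ((hb.sub ha).sub hδ) hWκ hZκ

variable {V : Type*} [NormedAddCommGroup V] [NormedSpace ℝ V] {O : Set V} {α : V → V →L[ℝ] 𝔸}
  {x x' ξ ξ' : ℝ → V}

lemma integral_coeff_variation_eq (hO : IsOpen O) (hα : ContDiffOn ℝ 1 α O)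
    (hx : HasLpDerivOn p s e x x') (hξ : HasLpDerivOn p s e ξ ξ') (hxO : MapsTo x (Icc s e) O)
    (hW : HasLpDerivOn p s e W (fun t => W t * α (x t) (x' t)))
    (hZ : HasLpDerivOn p s e Z (fun t => -(α (x t) (x' t) * Z t))) :
    ∫ t in s..e, W t * (fderiv ℝ α (x t) (ξ t) (x' t) + α (x t) (ξ' t)) * Z t
      = (∫ t in s..e, W t * curvForm α (x t) (ξ t) (x' t) * Z t)
        + (W e * α (x e) (ξ e) * Z e - W s * α (x s) (ξ s) * Z s) := by
  have hparts := (hW.mul ((hx.comp hO hα hxO).clm_apply hξ)).mul hZ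
  have hcurv : IntervalIntegrable (fun t => curvForm α (x t) (ξ t) (x' t)) volume s e :=
    (intervalIntegrable_iff_memLp_one hx.le).2
      ((memLp_curvForm hO hα hx hxO hξ.continuousOn).mono_exponent Fact.out)
  rw [← hparts.integral_eq, ← intervalIntegral.integral_add
    (intervalIntegrable_mul_mul hx.le hW.continuousOn hZ.continuousOn hcurv)
    hparts.intervalIntegrable]
  refine intervalIntegral.integral_congr fun t _ => ?_
  simp only [curvForm]
  noncomm_ring

end Variation

/-- The map `p ↦ a p ∈ L¹([s,e], F)` is Fréchet differentiable at `p₀` with derivative `p ↦ δ p`.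
Linearity of `δ` is not part of the notion. -/
structure HasL1FDerivAt {F : Type*} [NormedAddCommGroup F] {P : Type*} [NormedAddCommGroup P]
    (s e : ℝ) (a δ : P → ℝ → F) (p₀ : P) : Prop where
  near : ∀ᶠ p in 𝓝 p₀, IntervalIntegrable (a p) volume s e
  intervalIntegrable : ∀ p, IntervalIntegrable (δ p) volume s e
  bounded : ∃ C, ∀ p, ∫ t in s..e, ‖δ p t‖ ≤ C * ‖p‖
  isLittleO : (fun p => ∫ t in s..e, ‖a p t - a p₀ t - δ (p - p₀) t‖) =o[𝓝 p₀] (fun p => p - p₀)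

namespace HasL1FDerivAt

variable {P : Type*} [NormedAddCommGroup P] {s e : ℝ} {p₀ : P}

lemma isBigO {F : Type*} [NormedAddCommGroup F] {a δ : P → ℝ → F}
    (h : HasL1FDerivAt s e a δ p₀) (hse : s ≤ e) :
    (fun p => ∫ t in s..e, ‖a p t - a p₀ t‖) =O[𝓝 p₀] (fun p => p - p₀) := by
  obtain ⟨C, hC⟩ := h.bounded
  refine Asymptotics.IsBigO.of_bound (1 + C) ?_
  filter_upwards [h.near, h.isLittleO.def one_pos] with p hp hremainder
  rw [Real.norm_of_nonneg (intervalIntegral.integral_nonneg hse fun _ _ => norm_nonneg _),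
    one_mul] at hremainder
  rw [Real.norm_of_nonneg (intervalIntegral.integral_nonneg hse fun _ _ => norm_nonneg _), add_mul,
    one_mul]
  have hint := ((hp.sub h.near.self_of_nhds).sub (h.intervalIntegrable (p - p₀))).norm
  calc ∫ t in s..e, ‖a p t - a p₀ t‖
      ≤ ∫ t in s..e, (‖a p t - a p₀ t - δ (p - p₀) t‖ + ‖δ (p - p₀) t‖) :=
        integral_norm_le_of_norm_le hse (fun t _ => norm_le_norm_sub_add _ _)
          (hint.add (h.intervalIntegrable _).norm)
    _ = (∫ t in s..e, ‖a p t - a p₀ t - δ (p - p₀) t‖) + ∫ t in s..e, ‖δ (p - p₀) t‖ :=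
        intervalIntegral.integral_add hint (h.intervalIntegrable _).norm
    _ ≤ ‖p - p₀‖ + C * ‖p - p₀‖ := add_le_add hremainder (hC _)

variable {𝔸 : Type*} [NormedRing 𝔸] [NormedAlgebra ℝ 𝔸] [CompleteSpace 𝔸]
  {a δ : P → ℝ → 𝔸} {q : ℝ≥0∞} [Fact (1 ≤ q)] {W : ℝ → 𝔸} {Y : P → ℝ → 𝔸}

lemma norm_solution_sub_isLittleO (h : HasL1FDerivAt s e a δ p₀)
    (hW : HasLpDerivOn q s e W (fun t => W t * a p₀ t)) (hWs : W s = 1)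
    (hYW : ∀ t ∈ Icc s e, Y p₀ t * W t = 1)
    (hY : ∀ᶠ p in 𝓝 p₀, HasLpDerivOn q s e (Y p) (fun t => -(a p t * Y p t)) ∧ Y p s = 1) :
    (fun p => W e * Y p e - 1 + ∫ t in s..e, W t * δ (p - p₀) t * Y p₀ t)
      =o[𝓝 p₀] (fun p => p - p₀) := by
  have hse := hW.le
  have hY₀ : ContinuousOn (Y p₀) (Icc s e) := hY.self_of_nhds.1.continuousOn
  obtain ⟨κ₁, hκ₁⟩ := isCompact_Icc.exists_bound_of_continuousOn hW.continuousOn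
  obtain ⟨κ₂, hκ₂⟩ := isCompact_Icc.exists_bound_of_continuousOn hY₀
  let κ := max κ₁ κ₂
  have hsmallO : (fun p => κ ^ 2 * ∫ t in s..e, ‖a p t - a p₀ t‖) =O[𝓝 p₀] (fun p => p - p₀) :=
    (h.isBigO hse).const_mul_left _
  have hsub : Tendsto (fun p => p - p₀) (𝓝 p₀) (𝓝 0) :=
    (continuous_id.sub continuous_const).tendsto' _ _ (sub_self p₀)
  have hsmall : Tendsto (fun p => κ ^ 2 * ∫ t in s..e, ‖a p t - a p₀ t‖) (𝓝 p₀) (𝓝 0) :=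
    hsmallO.trans_tendsto hsub
  have hbound : (fun p => 2 * ‖(1 : 𝔸)‖ * (κ ^ 2 * ∫ t in s..e, ‖a p t - a p₀ t‖) ^ 2
      + κ ^ 2 * ∫ t in s..e, ‖a p t - a p₀ t - δ (p - p₀) t‖) =o[𝓝 p₀] (fun p => p - p₀) := by
    refine (Asymptotics.IsLittleO.const_mul_left ?_ _).add (h.isLittleO.const_mul_left _)
    have hsq := ((Asymptotics.isLittleO_one_iff ℝ).2 hsmall).mul_isBigO hsmallO.norm_right
    simp only [one_mul] at hsq
    simpa only [sq] using hsq.of_norm_right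
  refine Asymptotics.IsBigO.trans_isLittleO (Asymptotics.IsBigO.of_bound 1 ?_) hbound
  filter_upwards [h.near, hY, hsmall.eventually_le_const one_half_pos] with p hp hYp hsmallp
  rw [one_mul]
  exact (norm_solution_sub_variation_le hW hY₀ hYW hYp.1 hWs hYp.2 h.near.self_of_nhds hp
    (h.intervalIntegrable _) (fun t ht => (hκ₁ t ht).trans (le_max_left _ _))
    (fun t ht => (hκ₂ t ht).trans (le_max_right _ _)) hsmallp).trans (le_abs_self _)

lemma hasFDerivAt_solution [NormedSpace ℝ P] (h : HasL1FDerivAt s e a δ p₀)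
    (hW : HasLpDerivOn q s e W (fun t => W t * a p₀ t)) (hWs : W s = 1)
    (hYW : ∀ t ∈ Icc s e, Y p₀ t * W t = 1)
    (hY : ∀ᶠ p in 𝓝 p₀, HasLpDerivOn q s e (Y p) (fun t => -(a p t * Y p t)) ∧ Y p s = 1)
    {D : P →L[ℝ] 𝔸} (hD : ∀ p, D p = -(Y p₀ e * ∫ t in s..e, W t * δ p t * Y p₀ t)) :
    HasFDerivAt (fun p => Y p e) D p₀ := by
  rw [hasFDerivAt_iff_isLittleO]
  have hlittle := ((ContinuousLinearMap.mul ℝ 𝔸 (Y p₀ e)).isBigO_comp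
    (fun p => W e * Y p e - 1 + ∫ t in s..e, W t * δ (p - p₀) t * Y p₀ t) (𝓝 p₀)).trans_isLittleO
      (h.norm_solution_sub_isLittleO hW hWs hYW hY)
  refine hlittle.congr_left fun p => ?_
  rw [ContinuousLinearMap.mul_apply', hD, mul_add, mul_sub, ← mul_assoc,
    hYW e (right_mem_Icc.2 hW.le), one_mul, mul_one, sub_neg_eq_add]

end HasL1FDerivAt

/-- The family of curves `y p ∈ H¹([s,e], V)`, defined for `p` near `p₀`, is Fréchet differentiable
at `p₀` with derivative `p ↦ ξ p`. -/
structure HasH1FDerivAt {V : Type*} [NormedAddCommGroup V] [NormedSpace ℝ V] {P : Type*}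
    [NormedAddCommGroup P] [NormedSpace ℝ P] (s e : ℝ) (y : P → ℝ → V) (ξ : P →ₗ[ℝ] (ℝ → V))
    (p₀ : P) : Prop where
  lt : s < e
  near : ∀ᶠ p in 𝓝 p₀, HasLpDerivOn 2 s e (y p) (deriv (y p))
  tangent : ∀ p, HasLpDerivOn 2 s e (ξ p) (deriv (ξ p))
  bounded : ∃ C : ℝ, ∀ p, h1Norm s e (ξ p) ≤ C * ‖p‖
  isLittleO : (fun p => h1Norm s e (fun t => y p t - y p₀ t - ξ (p - p₀) t))
    =o[𝓝 p₀] (fun p => p - p₀)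

namespace HasH1FDerivAt

variable {V : Type*} [NormedAddCommGroup V] [NormedSpace ℝ V]
  {P : Type*} [NormedAddCommGroup P] [NormedSpace ℝ P]
  {s e : ℝ} {y : P → ℝ → V} {ξ : P →ₗ[ℝ] (ℝ → V)} {p₀ : P}

lemma base (h : HasH1FDerivAt s e y ξ p₀) : HasLpDerivOn 2 s e (y p₀) (deriv (y p₀)) :=
  h.near.self_of_nhds

section Coefficient

variable {F : Type*} [NormedAddCommGroup F] [NormedSpace ℝ F] {O : Set V} {α : V → V →L[ℝ] F}

lemma exists_coeff_bound (h : HasH1FDerivAt s e y ξ p₀) (hO : IsOpen O)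
    (hy : MapsTo (y p₀) (Icc s e) O) (hα : ContDiffOn ℝ 1 α O) :
    ∃ L : ℝ, 0 ≤ L ∧ ∀ t ∈ Icc s e, ‖α (y p₀ t)‖ ≤ L ∧ ‖fderiv ℝ α (y p₀ t)‖ ≤ L := by
  have hcont := h.base.continuousOn
  obtain ⟨L₁, hL₁⟩ := isCompact_Icc.exists_bound_of_continuousOn (hα.continuousOn.comp hcont hy)
  obtain ⟨L₂, hL₂⟩ := isCompact_Icc.exists_bound_of_continuousOn
    ((hα.continuousOn_fderiv_of_isOpen hO le_rfl).comp hcont hy)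
  exact ⟨max L₁ L₂, (norm_nonneg _).trans ((hL₁ s (left_mem_Icc.2 h.lt.le)).trans
    (le_max_left _ _)), fun t ht => ⟨(hL₁ t ht).trans (le_max_left _ _),
    (hL₂ t ht).trans (le_max_right _ _)⟩⟩

lemma intervalIntegrable_variation (h : HasH1FDerivAt s e y ξ p₀) (hO : IsOpen O)
    (hy : MapsTo (y p₀) (Icc s e) O) (hα : ContDiffOn ℝ 1 α O) (p : P) :
    IntervalIntegrable (fun t => fderiv ℝ α (y p₀ t) (ξ p t) (deriv (y p₀) t)
      + α (y p₀ t) (deriv (ξ p) t)) volume s e := by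
  have hcont := h.base.continuousOn
  have hderiv := (hα.continuousOn_fderiv_of_isOpen hO le_rfl).comp hcont hy
  refine (intervalIntegrable_iff_memLp_one h.lt.le).2 (MemLp.mono_exponent ?_ one_le_two)
  exact (memLp_clm_apply (hderiv.clm_apply (h.tangent p).continuousOn) h.base.memLp).add
    (memLp_clm_apply (hα.continuousOn.comp hcont hy) (h.tangent p).memLp)

end Coefficient

variable [CompleteSpace V]

lemma exists_tangent_bound (h : HasH1FDerivAt s e y ξ p₀) : ∃ K : ℝ, 0 ≤ K ∧
    ∀ p, (∀ t ∈ Icc s e, ‖ξ p t‖ ≤ K * ‖p‖) ∧ ∫ t in s..e, ‖deriv (ξ p) t‖ ≤ K * ‖p‖ := by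
  obtain ⟨C, hC⟩ := h.bounded
  have hK : 0 ≤ sobolevConst s e * |C| := mul_nonneg (sobolevConst_nonneg s e) (abs_nonneg C)
  have hle : ∀ p, sobolevConst s e * h1Norm s e (ξ p) ≤ sobolevConst s e * |C| * ‖p‖ := fun p => by
    rw [mul_assoc]
    exact mul_le_mul_of_nonneg_left ((hC p).trans (by gcongr; exact le_abs_self C))
      (sobolevConst_nonneg s e)
  exact ⟨_, hK, fun p => ⟨fun t ht => (norm_le_h1Norm h.lt (h.tangent p) ht).trans (hle p),
    (integral_norm_deriv_le_h1Norm (h.tangent p)).trans (hle p)⟩⟩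

lemma eventually_norm_remainder_le (h : HasH1FDerivAt s e y ξ p₀) {c : ℝ} (hc : 0 < c) :
    ∀ᶠ p in 𝓝 p₀, (∀ t ∈ Icc s e, ‖y p t - y p₀ t - ξ (p - p₀) t‖ ≤ c * ‖p - p₀‖) ∧
      ∫ t in s..e, ‖deriv (y p) t - deriv (y p₀) t - deriv (ξ (p - p₀)) t‖ ≤ c * ‖p - p₀‖ := by
  filter_upwards [h.near, (h.isLittleO.const_mul_left (sobolevConst s e)).def hc] with p hp hN
  have hremainder := (hp.sub h.base).sub (h.tangent (p - p₀))
  replace hN := (le_abs_self _).trans hN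
  exact ⟨fun t ht => (norm_le_h1Norm h.lt hremainder ht).trans hN,
    (integral_norm_deriv_le_h1Norm hremainder).trans hN⟩

lemma exists_increment_bound (h : HasH1FDerivAt s e y ξ p₀) : ∃ K : ℝ, 0 ≤ K ∧
    ∀ᶠ p in 𝓝 p₀, (∀ t ∈ Icc s e, ‖y p t - y p₀ t‖ ≤ K * ‖p - p₀‖) ∧
      ∫ t in s..e, ‖deriv (y p) t - deriv (y p₀) t‖ ≤ K * ‖p - p₀‖ := by
  obtain ⟨K, hK, htangent⟩ := h.exists_tangent_bound
  refine ⟨1 + K, by positivity, ?_⟩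
  filter_upwards [h.near, h.eventually_norm_remainder_le one_pos] with p hp hremainder
  obtain ⟨hξ, hξ'⟩ := htangent (p - p₀)
  have hint := ((hp.sub h.base).sub (h.tangent (p - p₀))).intervalIntegrable.norm
  have hintξ := (h.tangent (p - p₀)).intervalIntegrable.norm
  rw [add_mul]
  refine ⟨fun t ht => (norm_le_norm_sub_add _ _).trans
    (add_le_add (hremainder.1 t ht) (hξ t ht)), ?_⟩
  refine (integral_norm_le_of_norm_le h.lt.le (fun t _ => norm_le_norm_sub_add _ _)
    (hint.add hintξ)).trans ?_
  rw [intervalIntegral.integral_add hint hintξ]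
  exact add_le_add hremainder.2 hξ'

lemma eventually_norm_taylor_le (h : HasH1FDerivAt s e y ξ p₀) {F : Type*} [NormedAddCommGroup F]
    [NormedSpace ℝ F] {O : Set V} (hO : IsOpen O) (hy : MapsTo (y p₀) (Icc s e) O) {α : V → F}
    (hα : ContDiffOn ℝ 1 α O) {c : ℝ} (hc : 0 < c) :
    ∀ᶠ p in 𝓝 p₀, MapsTo (y p) (Icc s e) O ∧ ∀ t ∈ Icc s e,
      ‖α (y p t) - α (y p₀ t) - fderiv ℝ α (y p₀ t) (y p t - y p₀ t)‖ ≤ c * ‖p - p₀‖ := by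
  obtain ⟨K, hK, hincrement⟩ := h.exists_increment_bound
  obtain ⟨ρ, hρ, htaylor⟩ := exists_norm_taylor_le_of_isCompact hO hα
    (isCompact_Icc.image_of_continuousOn h.base.continuousOn) hy.image_subset
    (ε := c / (K + 1)) (by positivity)
  have hlim : Tendsto (fun p => K * ‖p - p₀‖) (𝓝 p₀) (𝓝 0) :=
    Continuous.tendsto' (by fun_prop) _ _ (by simp)
  filter_upwards [hincrement, hlim.eventually_lt_const hρ] with p hp hpρ
  have hnear := fun t (ht : t ∈ Icc s e) =>
    htaylor _ (mem_image_of_mem _ ht) (y p t) ((hp.1 t ht).trans_lt hpρ)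
  refine ⟨fun t ht => (hnear t ht).1, fun t ht => (hnear t ht).2.trans ?_⟩
  calc c / (K + 1) * ‖y p t - y p₀ t‖ ≤ c / (K + 1) * ((K + 1) * ‖p - p₀‖) := by
        have := hp.1 t ht
        gcongr
        nlinarith [norm_nonneg (p - p₀)]
    _ = c * ‖p - p₀‖ := by field_simp

lemma eventually_mapsTo (h : HasH1FDerivAt s e y ξ p₀) {O : Set V} (hO : IsOpen O)
    (hy : MapsTo (y p₀) (Icc s e) O) : ∀ᶠ p in 𝓝 p₀, MapsTo (y p) (Icc s e) O :=
  (h.eventually_norm_taylor_le hO hy (contDiffOn_const (c := (0 : ℝ))) one_pos).mono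
    fun _ hp => hp.1

lemma isBoundedLinearMap_eval (h : HasH1FDerivAt s e y ξ p₀) {t : ℝ} (ht : t ∈ Icc s e) :
    IsBoundedLinearMap ℝ (fun p => ξ p t) := by
  obtain ⟨K, -, hξ⟩ := h.exists_tangent_bound
  exact IsLinearMap.with_bound ⟨fun p q => by rw [map_add, Pi.add_apply],
    fun c p => by rw [map_smul, Pi.smul_apply]⟩ K fun p => (hξ p).1 t ht

lemma isBoundedLinearMap_integral (h : HasH1FDerivAt s e y ξ p₀) {F : Type*}
    [NormedAddCommGroup F] [NormedSpace ℝ F] {B : ℝ → V →L[ℝ] F}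
    (hB : IntervalIntegrable B volume s e) :
    IsBoundedLinearMap ℝ (fun p => ∫ t in s..e, B t (ξ p t)) := by
  obtain ⟨K, -, hξ⟩ := h.exists_tangent_bound
  have hint : ∀ p, IntervalIntegrable (fun t => B t (ξ p t)) volume s e := fun p => by
    have hcont : ContinuousOn (fun t => ContinuousLinearMap.apply ℝ F (ξ p t)) (Icc s e) :=
      (ContinuousLinearMap.apply ℝ F).continuous.comp_continuousOn (h.tangent p).continuousOn
    rw [intervalIntegrable_iff_memLp_one h.lt.le] at hB ⊢
    exact memLp_clm_apply (c := fun t => ContinuousLinearMap.apply ℝ F (ξ p t)) hcont hB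
  refine IsLinearMap.with_bound ⟨fun p q => ?_, fun c p => ?_⟩ ((∫ t in s..e, ‖B t‖) * K)
    fun p => ?_
  · simp only [map_add, Pi.add_apply]
    exact intervalIntegral.integral_add (hint p) (hint q)
  · simp only [map_smul, Pi.smul_apply]
    exact intervalIntegral.integral_smul c _
  · rw [mul_assoc, ← intervalIntegral.integral_mul_const]
    exact intervalIntegral.norm_integral_le_of_norm_le h.lt.le (Eventually.of_forall fun t ht =>
      (B t).le_opNorm_of_le ((hξ p).1 t (Ioc_subset_Icc_self ht))) (hB.norm.mul_const _)

section Coefficient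

variable {F : Type*} [NormedAddCommGroup F] [NormedSpace ℝ F] {O : Set V} {α : V → V →L[ℝ] F}

lemma exists_variation_bound (h : HasH1FDerivAt s e y ξ p₀) (hO : IsOpen O)
    (hy : MapsTo (y p₀) (Icc s e) O) (hα : ContDiffOn ℝ 1 α O) :
    ∃ C : ℝ, ∀ p, ∫ t in s..e, ‖fderiv ℝ α (y p₀ t) (ξ p t) (deriv (y p₀) t)
      + α (y p₀ t) (deriv (ξ p) t)‖ ≤ C * ‖p‖ := by
  obtain ⟨K, _, hξ⟩ := h.exists_tangent_bound
  obtain ⟨L, hL, hLα⟩ := h.exists_coeff_bound hO hy hα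
  refine ⟨L * K * (∫ t in s..e, ‖deriv (y p₀) t‖) + L * K, fun p => ?_⟩
  have hint₁ := h.base.intervalIntegrable.norm.const_mul (L * (K * ‖p‖))
  have hint₂ := (h.tangent p).intervalIntegrable.norm.const_mul L
  calc ∫ t in s..e, ‖fderiv ℝ α (y p₀ t) (ξ p t) (deriv (y p₀) t) + α (y p₀ t) (deriv (ξ p) t)‖
      ≤ ∫ t in s..e, (L * (K * ‖p‖) * ‖deriv (y p₀) t‖ + L * ‖deriv (ξ p) t‖) := by
        refine integral_norm_le_of_norm_le h.lt.le (fun t ht => norm_add_le_of_le ?_ ?_)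
          (hint₁.add hint₂)
        · refine (ContinuousLinearMap.le_opNorm₂ _ _ _).trans ?_
          gcongr
          · exact (hLα t ht).2
          · exact (hξ p).1 t ht
        · exact ContinuousLinearMap.le_of_opNorm_le _ (hLα t ht).1 _
    _ = L * (K * ‖p‖) * (∫ t in s..e, ‖deriv (y p₀) t‖) + L * ∫ t in s..e, ‖deriv (ξ p) t‖ := by
        rw [intervalIntegral.integral_add hint₁ hint₂, intervalIntegral.integral_const_mul,
          intervalIntegral.integral_const_mul]
    _ ≤ L * (K * ‖p‖) * (∫ t in s..e, ‖deriv (y p₀) t‖) + L * (K * ‖p‖) := by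
        gcongr
        exact (hξ p).2
    _ = (L * K * (∫ t in s..e, ‖deriv (y p₀) t‖) + L * K) * ‖p‖ := by ring

lemma exists_coeff_increment_bound (h : HasH1FDerivAt s e y ξ p₀) (hO : IsOpen O)
    (hy : MapsTo (y p₀) (Icc s e) O) (hα : ContDiffOn ℝ 1 α O) :
    ∃ K : ℝ, 0 ≤ K ∧ ∀ᶠ p in 𝓝 p₀, ∀ t ∈ Icc s e, ‖α (y p t) - α (y p₀ t)‖ ≤ K * ‖p - p₀‖ := by
  obtain ⟨K, hK, hincrement⟩ := h.exists_increment_bound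
  obtain ⟨L, hL, hLα⟩ := h.exists_coeff_bound hO hy hα
  refine ⟨1 + L * K, by positivity, ?_⟩
  filter_upwards [hincrement, h.eventually_norm_taylor_le hO hy hα one_pos] with p hp hp' t ht
  refine (norm_le_norm_sub_add _ (fderiv ℝ α (y p₀ t) (y p t - y p₀ t))).trans ?_
  rw [add_mul, mul_assoc]
  refine add_le_add (hp'.2 t ht) ((ContinuousLinearMap.le_opNorm _ _).trans ?_)
  gcongr
  · exact (hLα t ht).2
  · exact hp.1 t ht

lemma coeff_isLittleO (h : HasH1FDerivAt s e y ξ p₀) (hO : IsOpen O)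
    (hy : MapsTo (y p₀) (Icc s e) O) (hα : ContDiffOn ℝ 1 α O) :
    (fun p => ∫ t in s..e, ‖α (y p t) (deriv (y p) t) - α (y p₀ t) (deriv (y p₀) t)
        - (fderiv ℝ α (y p₀ t) (ξ (p - p₀) t) (deriv (y p₀) t)
          + α (y p₀ t) (deriv (ξ (p - p₀)) t))‖)
      =o[𝓝 p₀] (fun p => p - p₀) := by
  obtain ⟨K, _, hincrement⟩ := h.exists_increment_bound
  obtain ⟨K', hK', hcoeff⟩ := h.exists_coeff_increment_bound hO hy hα
  obtain ⟨L, hL, hLα⟩ := h.exists_coeff_bound hO hy hα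
  let I := ∫ t in s..e, ‖deriv (y p₀) t‖
  have hI : 0 ≤ I := intervalIntegral.integral_nonneg h.lt.le fun _ _ => norm_nonneg _
  refine Asymptotics.isLittleO_iff.2 fun c hc => ?_
  let ε := c / ((1 + L) * I + 1 + L)
  have hε : 0 < ε := by positivity
  have hlim : Tendsto (fun p => K' * K * ‖p - p₀‖) (𝓝 p₀) (𝓝 0) :=
    Continuous.tendsto' (by fun_prop) _ _ (by simp)
  filter_upwards [h.near, hincrement, hcoeff, h.eventually_norm_remainder_le hε,
    h.eventually_norm_taylor_le hO hy hα hε, hlim.eventually_le_const hε]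
    with p hp hincrement hcoeff hremainder htaylor hsmall
  rw [Real.norm_of_nonneg (intervalIntegral.integral_nonneg h.lt.le fun _ _ => norm_nonneg _)]
  refine (integral_norm_coeff_sub_le h.lt.le h.base.intervalIntegrable hp.intervalIntegrable
    (h.tangent (p - p₀)).intervalIntegrable (fun t ht => (hLα t ht).1) (fun t ht => (hLα t ht).2)
    hcoeff htaylor.2 hremainder.1).trans ?_
  calc (ε * ‖p - p₀‖ + L * (ε * ‖p - p₀‖)) * I
        + K' * ‖p - p₀‖ * (∫ t in s..e, ‖deriv (y p) t - deriv (y p₀) t‖)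
        + L * ∫ t in s..e, ‖deriv (y p) t - deriv (y p₀) t - deriv (ξ (p - p₀)) t‖
      ≤ (ε * ‖p - p₀‖ + L * (ε * ‖p - p₀‖)) * I + K' * ‖p - p₀‖ * (K * ‖p - p₀‖)
        + L * (ε * ‖p - p₀‖) := by
        gcongr
        · exact hincrement.2
        · exact hremainder.2
    _ = ((1 + L) * I * ε + K' * K * ‖p - p₀‖ + L * ε) * ‖p - p₀‖ := by ring
    _ ≤ ((1 + L) * I * ε + ε + L * ε) * ‖p - p₀‖ := by gcongr
    _ = c * ‖p - p₀‖ := by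
        simp only [ε]
        field_simp

lemma hasL1FDerivAt_coeff (h : HasH1FDerivAt s e y ξ p₀) (hO : IsOpen O)
    (hy : MapsTo (y p₀) (Icc s e) O) (hα : ContDiffOn ℝ 1 α O) :
    HasL1FDerivAt s e (fun p t => α (y p t) (deriv (y p) t))
      (fun p t => fderiv ℝ α (y p₀ t) (ξ p t) (deriv (y p₀) t) + α (y p₀ t) (deriv (ξ p) t))
      p₀ where
  near := by
    filter_upwards [h.near, h.eventually_mapsTo hO hy] with p hp hpO
    exact (intervalIntegrable_iff_memLp_one h.lt.le).2 ((memLp_clm_apply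
      (hα.continuousOn.comp hp.continuousOn hpO) hp.memLp).mono_exponent one_le_two)
  intervalIntegrable := h.intervalIntegrable_variation hO hy hα
  bounded := h.exists_variation_bound hO hy hα
  isLittleO := h.coeff_isLittleO hO hy hα

end Coefficient

section Solution

variable {𝔸 : Type*} [NormedRing 𝔸] [NormedAlgebra ℝ 𝔸] {O : Set V} {α : V → V →L[ℝ] 𝔸}
  {W Z : ℝ → 𝔸}

lemma isBoundedLinearMap_integral_curvForm (h : HasH1FDerivAt s e y ξ p₀) (hO : IsOpen O)
    (hy : MapsTo (y p₀) (Icc s e) O) (hα : ContDiffOn ℝ 1 α O) (hW : ContinuousOn W (Icc s e))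
    (hZ : ContinuousOn Z (Icc s e)) :
    IsBoundedLinearMap ℝ
      (fun p => ∫ t in s..e, W t * curvForm α (y p₀ t) (ξ p t) (deriv (y p₀) t) * Z t) := by
  have hmul : ContinuousOn
      (fun t => ContinuousLinearMap.compL ℝ V 𝔸 𝔸
        (ContinuousLinearMap.mulLeftRight ℝ 𝔸 (W t) (Z t))) (Icc s e) :=
    (ContinuousLinearMap.compL ℝ V 𝔸 𝔸).continuous.comp_continuousOn
      (((ContinuousLinearMap.mulLeftRight ℝ 𝔸).continuous.comp_continuousOn hW).clm_apply hZ)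
  have hflip : ContinuousOn (fun t => (curvCLM α (y p₀ t)).flip) (Icc s e) :=
    (ContinuousLinearMap.flipₗᵢ ℝ V V 𝔸).continuous.comp_continuousOn
      ((continuousOn_curvCLM hO hα).comp h.base.continuousOn hy)
  have hint := (intervalIntegrable_iff_memLp_one h.lt.le).2
    ((memLp_clm_apply hmul (memLp_clm_apply hflip h.base.memLp)).mono_exponent one_le_two)
  simpa only [ContinuousLinearMap.compL_apply, ContinuousLinearMap.comp_apply,
    ContinuousLinearMap.flip_apply, ContinuousLinearMap.mulLeftRight_apply, curvCLM_apply]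
    using h.isBoundedLinearMap_integral hint

lemma hasFDerivAt_solution [CompleteSpace 𝔸] (h : HasH1FDerivAt s e y ξ p₀) (hO : IsOpen O)
    (hy : MapsTo (y p₀) (Icc s e) O) (hα : ContDiffOn ℝ 1 α O) {Y : P → ℝ → 𝔸}
    (hW : HasLpDerivOn 2 s e W (fun t => W t * α (y p₀ t) (deriv (y p₀) t))) (hWs : W s = 1)
    (hYW : ∀ t ∈ Icc s e, Y p₀ t * W t = 1)
    (hY : ∀ᶠ p in 𝓝 p₀,
      HasLpDerivOn 2 s e (Y p) (fun t => -(α (y p t) (deriv (y p) t) * Y p t)) ∧ Y p s = 1) :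
    ∃ D : P →L[ℝ] 𝔸, (∀ p, D p = -(Y p₀ e * ∫ t in s..e,
        W t * curvForm α (y p₀ t) (ξ p t) (deriv (y p₀) t) * Y p₀ t)
        - α (y p₀ e) (ξ p e) * Y p₀ e + Y p₀ e * α (y p₀ s) (ξ p s)) ∧
      HasFDerivAt (fun p => Y p e) D p₀ := by
  obtain ⟨hY₀, hY₀s⟩ := hY.self_of_nhds
  have hs : s ∈ Icc s e := left_mem_Icc.2 h.lt.le
  have he : e ∈ Icc s e := right_mem_Icc.2 h.lt.le
  have hcurv := (ContinuousLinearMap.mul ℝ 𝔸 (Y p₀ e)).isBoundedLinearMap.comp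
    (h.isBoundedLinearMap_integral_curvForm hO hy hα hW.continuousOn hY₀.continuousOn)
  have hend := ((ContinuousLinearMap.mul ℝ 𝔸).flip (Y p₀ e)).isBoundedLinearMap.comp
    ((α (y p₀ e)).isBoundedLinearMap.comp (h.isBoundedLinearMap_eval he))
  have hstart := (ContinuousLinearMap.mul ℝ 𝔸 (Y p₀ e)).isBoundedLinearMap.comp
    ((α (y p₀ s)).isBoundedLinearMap.comp (h.isBoundedLinearMap_eval hs))
  let D := ((hcurv.neg.sub hend).add hstart).toContinuousLinearMap
  refine ⟨D, fun p => rfl, ?_⟩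
  refine (h.hasL1FDerivAt_coeff hO hy hα).hasFDerivAt_solution hW hWs hYW hY fun p => ?_
  rw [integral_coeff_variation_eq hO hα h.base (h.tangent p) hy hW hY₀, hWs, hY₀s, one_mul,
    mul_one, mul_add, mul_sub, ← mul_assoc _ (W e * _), ← mul_assoc _ (W e), hYW e he, one_mul]
  have hDp : D p = -(Y p₀ e * ∫ t in s..e,
      W t * curvForm α (y p₀ t) (ξ p t) (deriv (y p₀) t) * Y p₀ t)
      - α (y p₀ e) (ξ p e) * Y p₀ e + Y p₀ e * α (y p₀ s) (ξ p s) := rfl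
  rw [hDp]
  abel

end Solution

end HasH1FDerivAt

/-! ### Covariance of the curvature -/

section Covariance

variable {V V₂ : Type*} [NormedAddCommGroup V] [NormedSpace ℝ V] [NormedAddCommGroup V₂]
  [NormedSpace ℝ V₂] {𝔸 : Type*} [NormedRing 𝔸] [NormedAlgebra ℝ 𝔸]

lemma fderiv_gauge {α β : V → V →L[ℝ] 𝔸} {g : V → 𝔸} {y : V} (hα : DifferentiableAt ℝ α y)
    (hβ : DifferentiableAt ℝ β y) (hg : ContDiffAt ℝ 2 g y)
    (h : ∀ᶠ z in 𝓝 y, ∀ w, g z * β z w = α z w * g z + fderiv ℝ g z w) (u v : V) :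
    fderiv ℝ g y u * β y v + g y * fderiv ℝ β y u v
      = fderiv ℝ α y u v * g y + α y v * fderiv ℝ g y u + fderiv ℝ (fderiv ℝ g) y u v := by
  have hg₁ := (hg.differentiableAt two_ne_zero).hasFDerivAt
  have hg₂ := ((hg.fderiv_right (m := 1) le_rfl).differentiableAt one_ne_zero).hasFDerivAt
  have hv := hasFDerivAt_const (𝕜 := ℝ) v y
  have hlhs := hg₁.mul' (hβ.hasFDerivAt.clm_apply hv)
  have hrhs := ((hα.hasFDerivAt.clm_apply hv).mul' hg₁).add (hg₂.clm_apply hv)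
  have heq := hlhs.unique (hrhs.congr_of_eventuallyEq (h.mono fun z hz => hz v))
  simpa [add_comm] using DFunLike.congr_fun heq u

lemma curvForm_gauge {α β : V → V →L[ℝ] 𝔸} {g : V → 𝔸} {y : V} (hα : DifferentiableAt ℝ α y)
    (hβ : DifferentiableAt ℝ β y) (hg : ContDiffAt ℝ 2 g y)
    (h : ∀ᶠ z in 𝓝 y, ∀ w, g z * β z w = α z w * g z + fderiv ℝ g z w) (u v : V) :
    g y * curvForm β y u v = curvForm α y u v * g y := by
  have huv := fderiv_gauge hα hβ hg h u v
  have hvu := fderiv_gauge hα hβ hg h v u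
  rw [hg.isSymmSndFDerivAt (by simp) u v] at huv
  have hu := h.self_of_nhds u
  have hv := h.self_of_nhds v
  rw [curvForm, curvForm]
  linear_combination (norm := noncomm_ring)
    huv - hvu + hu * β y v - hv * β y u + α y u * hv - α y v * hu

lemma fderiv_pullback {α : V → V →L[ℝ] 𝔸} {β : V₂ → V₂ →L[ℝ] 𝔸} {τ : V → V₂} {y : V}
    (hα : DifferentiableAt ℝ α y) (hβ : DifferentiableAt ℝ β (τ y)) (hτ : ContDiffAt ℝ 2 τ y)
    (h : ∀ᶠ z in 𝓝 y, ∀ w, α z w = β (τ z) (fderiv ℝ τ z w)) (u v : V) :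
    fderiv ℝ α y u v = fderiv ℝ β (τ y) (fderiv ℝ τ y u) (fderiv ℝ τ y v)
      + β (τ y) (fderiv ℝ (fderiv ℝ τ) y u v) := by
  have hτ₁ := (hτ.differentiableAt two_ne_zero).hasFDerivAt
  have hτ₂ := ((hτ.fderiv_right (m := 1) le_rfl).differentiableAt one_ne_zero).hasFDerivAt
  have hv := hasFDerivAt_const (𝕜 := ℝ) v y
  have hlhs := hα.hasFDerivAt.clm_apply hv
  have hrhs := (hβ.hasFDerivAt.comp y hτ₁).clm_apply (hτ₂.clm_apply hv)
  have heq := hlhs.unique (hrhs.congr_of_eventuallyEq (h.mono fun z hz => hz v))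
  simpa [add_comm] using DFunLike.congr_fun heq u

lemma curvForm_pullback {α : V → V →L[ℝ] 𝔸} {β : V₂ → V₂ →L[ℝ] 𝔸} {τ : V → V₂} {y : V}
    (hα : DifferentiableAt ℝ α y) (hβ : DifferentiableAt ℝ β (τ y)) (hτ : ContDiffAt ℝ 2 τ y)
    (h : ∀ᶠ z in 𝓝 y, ∀ w, α z w = β (τ z) (fderiv ℝ τ z w)) (u v : V) :
    curvForm α y u v = curvForm β (τ y) (fderiv ℝ τ y u) (fderiv ℝ τ y v) := by
  simp only [curvForm, fderiv_pullback hα hβ hτ h, hτ.isSymmSndFDerivAt (by simp) u v,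
    h.self_of_nhds _]
  abel

end Covariance

section Charts

lemma mem_target_inter_preimage_symm {X Y : Type*} [TopologicalSpace X] [TopologicalSpace Y]
    {φ : OpenPartialHomeomorph X Y} {S : Set X} {x : X} (hx : x ∈ φ.source) (hxS : x ∈ S) :
    φ x ∈ φ.target ∩ φ.symm ⁻¹' S :=
  ⟨φ.map_source hx, by rwa [mem_preimage, φ.left_inv hx]⟩

variable {d : ℕ} {M : Type*} [TopologicalSpace M] [ChartedSpace (EuclideanSpace ℝ (Fin d)) M]

lemma exists_chart_subset [IsManifold (𝓡 d) ∞ M] (x : M) {S : Set M} (hS : IsOpen S)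
    (hx : x ∈ S) : ∃ φ ∈ charts d M, x ∈ φ.source ∧ φ.source ⊆ S := by
  have hsource : ((chartAt (EuclideanSpace ℝ (Fin d)) x).restr S).source
      = (chartAt (EuclideanSpace ℝ (Fin d)) x).source ∩ S := by
    rw [OpenPartialHomeomorph.restr_source, hS.interior_eq]
  exact ⟨_, restr_mem_maximalAtlas _ (IsManifold.chart_mem_maximalAtlas x) hS,
    hsource ▸ ⟨mem_chart_source _ x, hx⟩, hsource ▸ inter_subset_right⟩

variable {φ φ₁ φ₂ : OpenPartialHomeomorph M (EuclideanSpace ℝ (Fin d))}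

lemma mdifferentiable_of_mem_charts (hφ : φ ∈ charts d M) : φ.MDifferentiable (𝓡 d) (𝓡 d) :=
  ⟨(contMDiffOn_of_mem_maximalAtlas hφ).mdifferentiableOn (by simp),
    (contMDiffOn_symm_of_mem_maximalAtlas hφ).mdifferentiableOn (by simp)⟩

lemma mfderiv_symm_mfderiv (hφ : φ ∈ charts d M) {x : M} (hx : x ∈ φ.source)
    (v : TangentSpace (𝓡 d) x) :
    mfderiv (𝓡 d) (𝓡 d) φ.symm (φ x) (mfderiv (𝓡 d) (𝓡 d) φ x v) = v :=
  DFunLike.congr_fun ((mdifferentiable_of_mem_charts hφ).symm_comp_deriv hx) v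

lemma mfderiv_velocity (hφ : φ ∈ charts d M) {γ : ℝ → M} {t : ℝ} (hγ : ContinuousAt γ t)
    (ht : γ t ∈ φ.source) {v : EuclideanSpace ℝ (Fin d)}
    (hv : HasDerivAt (fun τ => φ (γ τ)) v t) :
    mfderiv (𝓡 d) (𝓡 d) φ (γ t) (velocity d γ t) = v := by
  have hMD := mdifferentiable_of_mem_charts hφ
  have hlift : γ =ᶠ[𝓝 t] (φ.symm ∘ fun τ => φ (γ τ)) := by
    filter_upwards [hγ.eventually_mem (φ.open_source.mem_nhds ht)] with τ hτ
    exact (φ.left_inv hτ).symm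
  have hγ' : MDifferentiableAt 𝓘(ℝ, ℝ) (𝓡 d) γ t :=
    ((hMD.mdifferentiableAt_symm (φ.map_source ht)).comp t
      hv.differentiableAt.mdifferentiableAt).congr_of_eventuallyEq hlift
  have hcomp : mfderiv 𝓘(ℝ, ℝ) (𝓡 d) (φ ∘ γ) t (1 : ℝ) = v := by
    rw [mfderiv_eq_fderiv]
    exact hv.deriv
  rw [← hcomp, mfderiv_comp t (hMD.mdifferentiableAt ht) hγ']
  rfl

section Functions

variable {F : Type*} [NormedAddCommGroup F] [NormedSpace ℝ F] {f : M → F}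

lemma contDiffOn_comp_symm {S : Set M} (hf : ContMDiffOn (𝓡 d) 𝓘(ℝ, F) ∞ f S)
    (hφ : φ ∈ charts d M) :
    ContDiffOn ℝ ∞ (fun y => f (φ.symm y)) (φ.target ∩ φ.symm ⁻¹' S) := by
  rw [← contMDiffOn_iff_contDiffOn]
  exact hf.comp ((contMDiffOn_symm_of_mem_maximalAtlas hφ).mono inter_subset_left)
    inter_subset_right

lemma fderiv_comp_symm (hφ : φ ∈ charts d M) {y : EuclideanSpace ℝ (Fin d)} (hy : y ∈ φ.target)
    (hf : MDifferentiableAt (𝓡 d) 𝓘(ℝ, F) f (φ.symm y)) (w : EuclideanSpace ℝ (Fin d)) :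
    fderiv ℝ (fun z => f (φ.symm z)) y w
      = mvfderiv (𝓡 d) f (φ.symm y) (mfderiv (𝓡 d) (𝓡 d) φ.symm y w) := by
  have hcomp := mfderiv_comp y hf ((mdifferentiable_of_mem_charts hφ).mdifferentiableAt_symm hy)
  rw [← mfderiv_eq_fderiv (f := fun z => f (φ.symm z))]
  exact DFunLike.congr_fun hcomp w

lemma fderiv_comp_symm_mfderiv (hφ : φ ∈ charts d M) {x : M} (hx : x ∈ φ.source)
    (hf : MDifferentiableAt (𝓡 d) 𝓘(ℝ, F) f x) (v : TangentSpace (𝓡 d) x) :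
    fderiv ℝ (fun z => f (φ.symm z)) (φ x) (mfderiv (𝓡 d) (𝓡 d) φ x v) = mvfderiv (𝓡 d) f x v := by
  have hbase : ∀ {y}, y = x → ∀ w : EuclideanSpace ℝ (Fin d),
      mvfderiv (𝓡 d) f y w = mvfderiv (𝓡 d) f x w := by
    rintro _ rfl w
    rfl
  exact (fderiv_comp_symm hφ (φ.map_source hx) (by rwa [φ.left_inv hx]) _).trans
    ((hbase (φ.left_inv hx) _).trans (congrArg _ (mfderiv_symm_mfderiv hφ hx v)))

end Functions

variable {N : ℕ} {θ : ∀ x : M, TangentSpace (𝓡 d) x →L[ℝ] Mat N}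

lemma formCoord_mfderiv (hφ : φ ∈ charts d M) (θ : ∀ x : M, TangentSpace (𝓡 d) x →L[ℝ] Mat N)
    {x : M} (hx : x ∈ φ.source) (v : TangentSpace (𝓡 d) x) :
    formCoord φ θ (φ x) (mfderiv (𝓡 d) (𝓡 d) φ x v) = θ x v := by
  have hbase : ∀ {y}, y = x → ∀ w : EuclideanSpace ℝ (Fin d), θ y w = θ x w := by
    rintro _ rfl w
    rfl
  exact (hbase (φ.left_inv hx) _).trans (congrArg (θ x) (mfderiv_symm_mfderiv hφ hx v))

lemma curvForm_formCoord_eq (hφ₁ : φ₁ ∈ charts d M) (hφ₂ : φ₂ ∈ charts d M) {x : M}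
    (hx₁ : x ∈ φ₁.source) (hx₂ : x ∈ φ₂.source)
    (hθ₁ : DifferentiableAt ℝ (formCoord φ₁ θ) (φ₁ x))
    (hθ₂ : DifferentiableAt ℝ (formCoord φ₂ θ) (φ₂ x)) (u v : TangentSpace (𝓡 d) x) :
    curvForm (formCoord φ₁ θ) (φ₁ x) (mfderiv (𝓡 d) (𝓡 d) φ₁ x u) (mfderiv (𝓡 d) (𝓡 d) φ₁ x v)
      = curvForm (formCoord φ₂ θ) (φ₂ x) (mfderiv (𝓡 d) (𝓡 d) φ₂ x u)
        (mfderiv (𝓡 d) (𝓡 d) φ₂ x v) := by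
  let τ : EuclideanSpace ℝ (Fin d) → EuclideanSpace ℝ (Fin d) := fun y => φ₂ (φ₁.symm y)
  have hMD := mdifferentiable_of_mem_charts hφ₂
  have hO : φ₁.target ∩ φ₁.symm ⁻¹' φ₂.source ∈ 𝓝 (φ₁ x) :=
    (φ₁.isOpen_inter_preimage_symm φ₂.open_source).mem_nhds
      (mem_target_inter_preimage_symm hx₁ hx₂)
  have hτx : τ (φ₁ x) = φ₂ x := congrArg φ₂ (φ₁.left_inv hx₁)
  have hτ : ContDiffAt ℝ 2 τ (φ₁ x) :=
    ((contDiffOn_comp_symm (contMDiffOn_of_mem_maximalAtlas hφ₂) hφ₁).contDiffAt hO).of_le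
      ENat.LEInfty.out
  have hτ' : ∀ w : TangentSpace (𝓡 d) x, fderiv ℝ τ (φ₁ x) (mfderiv (𝓡 d) (𝓡 d) φ₁ x w)
      = mfderiv (𝓡 d) (𝓡 d) φ₂ x w :=
    fderiv_comp_symm_mfderiv hφ₁ hx₁ (hMD.mdifferentiableAt hx₂)
  have hpullback : ∀ᶠ y in 𝓝 (φ₁ x), ∀ w,
      formCoord φ₁ θ y w = formCoord φ₂ θ (τ y) (fderiv ℝ τ y w) := by
    filter_upwards [hO] with y hy w
    exact ((congrArg _ (fderiv_comp_symm hφ₁ hy.1 (hMD.mdifferentiableAt hy.2) w)).trans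
      (formCoord_mfderiv hφ₂ θ hy.2 _)).symm
  have hcurv := curvForm_pullback hθ₁ (hτx.symm ▸ hθ₂) hτ hpullback
    (mfderiv (𝓡 d) (𝓡 d) φ₁ x u) (mfderiv (𝓡 d) (𝓡 d) φ₁ x v)
  rw [hτx] at hcurv
  exact hcurv.trans (congrArg₂ _ (hτ' u) (hτ' v))

end Charts

section Bundles

variable {d : ℕ} {M : Type*} [TopologicalSpace M] [ChartedSpace (EuclideanSpace ℝ (Fin d)) M]
  {N : ℕ} {G : Subgroup (Matrix.specialUnitaryGroup (Fin N) ℂ)}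
  {E : M → Type*} [∀ x, AddCommGroup (E x)] [∀ x, Module ℂ (E x)]

namespace GBundle

variable (B : GBundle d G E)

lemma matrixOf_comp (a b c : B.ι) {x y z : M} (T : E y →ₗ[ℂ] E z) (S : E x →ₗ[ℂ] E y) :
    B.matrixOf c a (T ∘ₗ S) = B.matrixOf c b T * B.matrixOf b a S := by
  rw [matrixOf, matrixOf, matrixOf, ← LinearMap.toMatrix'_comp]
  congr 1
  ext v
  simp

lemma matrixOf_id (a b : B.ι) (x : M) :
    B.matrixOf b a (LinearMap.id : E x →ₗ[ℂ] E x) = B.transition b a x := rfl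

lemma transition_self (a : B.ι) (x : M) : B.transition a a x = 1 := by
  rw [transition, ← LinearMap.toMatrix'_id]
  congr 1
  ext v
  simp

lemma transition_mul_transition (a b c : B.ι) (x : M) :
    B.transition c b x * B.transition b a x = B.transition c a x := by
  rw [← matrixOf_id, ← matrixOf_id, ← matrixOf_comp, LinearMap.id_comp, matrixOf_id]

lemma transition_mul_transition_self (a b : B.ι) (x : M) :
    B.transition a b x * B.transition b a x = 1 := by
  rw [transition_mul_transition, transition_self]

lemma transition_inv (a b : B.ι) (x : M) : (B.transition a b x)⁻¹ = B.transition b a x :=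
  Matrix.inv_eq_left_inv (B.transition_mul_transition_self b a x)

lemma matrixOf_eq (a b a' b' : B.ι) {x y : M} (T : E x →ₗ[ℂ] E y) :
    B.matrixOf b a T = B.transition b b' y * B.matrixOf b' a' T * B.transition a' a x := by
  rw [← matrixOf_id, ← matrixOf_id, ← matrixOf_comp, ← matrixOf_comp]
  rfl

lemma mdifferentiableAt_transition {a b : B.ι} {x : M} (hx : x ∈ B.W a ∩ B.W b) :
    MDifferentiableAt (𝓡 d) 𝓘(ℝ, Mat N) (B.transition a b) x :=
  ((B.transition_smooth a b).contMDiffAt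
    (((B.isOpen_W a).inter (B.isOpen_W b)).mem_nhds hx)).mdifferentiableAt (by simp)

end GBundle

namespace Connection

variable {B : GBundle d G E} (A : Connection B)
  {φ : OpenPartialHomeomorph M (EuclideanSpace ℝ (Fin d))}

lemma transition_mul_form {a b : B.ι} {x : M} (hx : x ∈ B.W a ∩ B.W b)
    (v : TangentSpace (𝓡 d) x) :
    B.transition a b x * A.A b x v
      = A.A a x v * B.transition a b x + mvfderiv (𝓡 d) (B.transition a b) x v := by
  rw [A.compat a b x hx v, B.transition_inv, mul_add, ← mul_assoc, ← mul_assoc, ← mul_assoc,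
    B.transition_mul_transition_self, one_mul, one_mul]

lemma transition_mul_formCoord (hφ : φ ∈ charts d M) {a b : B.ι} {y : EuclideanSpace ℝ (Fin d)}
    (hy : y ∈ φ.target ∩ φ.symm ⁻¹' (B.W a ∩ B.W b)) (w : EuclideanSpace ℝ (Fin d)) :
    B.transition a b (φ.symm y) * formCoord φ (A.A b) y w
      = formCoord φ (A.A a) y w * B.transition a b (φ.symm y)
        + fderiv ℝ (fun z => B.transition a b (φ.symm z)) y w := by
  rw [fderiv_comp_symm hφ hy.1 (B.mdifferentiableAt_transition hy.2)]
  exact A.transition_mul_form hy.2 _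

lemma differentiableAt_formCoord (hφ : φ ∈ charts d M) {a : B.ι} {x : M} (hx : x ∈ φ.source)
    (ha : x ∈ B.W a) : DifferentiableAt ℝ (formCoord φ (A.A a)) (φ x) :=
  ((A.smooth a φ hφ).contDiffAt ((φ.isOpen_inter_preimage_symm (B.isOpen_W a)).mem_nhds
    (mem_target_inter_preimage_symm hx ha))).differentiableAt (by simp)

lemma transition_mul_curvForm (hφ : φ ∈ charts d M) {a b : B.ι} {x : M} (hx : x ∈ φ.source)
    (ha : x ∈ B.W a) (hb : x ∈ B.W b) (u v : EuclideanSpace ℝ (Fin d)) :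
    B.transition a b x * curvForm (formCoord φ (A.A b)) (φ x) u v
      = curvForm (formCoord φ (A.A a)) (φ x) u v * B.transition a b x := by
  have hO : φ.target ∩ φ.symm ⁻¹' (B.W a ∩ B.W b) ∈ 𝓝 (φ x) :=
    (φ.isOpen_inter_preimage_symm ((B.isOpen_W a).inter (B.isOpen_W b))).mem_nhds
      (mem_target_inter_preimage_symm hx ⟨ha, hb⟩)
  have hsmooth : ContDiffAt ℝ 2 (fun z => B.transition a b (φ.symm z)) (φ x) :=
    ((contDiffOn_comp_symm (B.transition_smooth a b) hφ).contDiffAt hO).of_le ENat.LEInfty.out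
  have hgauge := curvForm_gauge (A.differentiableAt_formCoord hφ hx ha)
    (A.differentiableAt_formCoord hφ hx hb) hsmooth
    (by filter_upwards [hO] with y hy w using A.transition_mul_formCoord hφ hy w) u v
  rwa [φ.left_inv hx] at hgauge

variable [IsManifold (𝓡 d) ∞ M]

lemma localCurvature_eq_curvForm (hφ : φ ∈ charts d M) {a : B.ι} {x : M} (hx : x ∈ φ.source)
    (ha : x ∈ B.W a) (u v : TangentSpace (𝓡 d) x) :
    A.localCurvature a x u v = curvForm (formCoord φ (A.A a)) (φ x)
      (mfderiv (𝓡 d) (𝓡 d) φ x u) (mfderiv (𝓡 d) (𝓡 d) φ x v) := by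
  have hc : chartAt (EuclideanSpace ℝ (Fin d)) x ∈ charts d M :=
    IsManifold.chart_mem_maximalAtlas x
  have hx' := mem_chart_source (EuclideanSpace ℝ (Fin d)) x
  rw [← curvForm_formCoord_eq hc hφ hx' hx (A.differentiableAt_formCoord hc hx' ha)
    (A.differentiableAt_formCoord hφ hx ha)]
  exact (congrArg₂ (fun p q : Mat N => _ + (p * q - q * p))
    (formCoord_mfderiv hc (A.A a) hx' u) (formCoord_mfderiv hc (A.A a) hx' v)).symm

lemma transition_mul_localCurvature {a b : B.ι} {x : M} (ha : x ∈ B.W a) (hb : x ∈ B.W b)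
    (u v : TangentSpace (𝓡 d) x) :
    B.transition a b x * A.localCurvature b x u v
      = A.localCurvature a x u v * B.transition a b x := by
  have hc : chartAt (EuclideanSpace ℝ (Fin d)) x ∈ charts d M :=
    IsManifold.chart_mem_maximalAtlas x
  have hx := mem_chart_source (EuclideanSpace ℝ (Fin d)) x
  rw [A.localCurvature_eq_curvForm hc hx ha, A.localCurvature_eq_curvForm hc hx hb]
  exact A.transition_mul_curvForm hc hx ha hb _ _

lemma matrixOf_curvature {a : B.ι} {x : M} (ha : x ∈ B.W a) (u v : TangentSpace (𝓡 d) x) :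
    B.matrixOf a a (A.curvature x u v) = A.localCurvature a x u v := by
  let b := (B.cover x).choose
  have hb : x ∈ B.W b := (B.cover x).choose_spec
  have hchoice : B.matrixOf b b (A.curvature x u v) = A.localCurvature b x u v := by
    rw [← LinearMap.toMatrix'_toLin' (A.localCurvature b x u v), GBundle.matrixOf, curvature]
    congr 1
    ext w
    simp [b]
  rw [B.matrixOf_eq a a b b, hchoice, A.transition_mul_localCurvature ha hb, mul_assoc,
    B.transition_mul_transition_self, mul_one]

end Connection

end Bundles

/-! ### Existence of the parallel transport -/

lemma HasLpDerivOn.ringInverse_solution {𝔸 : Type*} [NormedRing 𝔸] [NormedAlgebra ℝ 𝔸]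
    [CompleteSpace 𝔸] {p : ℝ≥0∞} {a b : ℝ} {f k : ℝ → 𝔸}
    (hf : HasLpDerivOn p a b f (fun t => -(k t * f t))) (hu : ∀ t ∈ Icc a b, IsUnit (f t)) :
    HasLpDerivOn p a b (fun t => Ring.inverse (f t)) (fun t => Ring.inverse (f t) * k t) := by
  have hC : ContDiffOn ℝ 1 (Ring.inverse : 𝔸 → 𝔸) {x | IsUnit x} := by
    rintro _ ⟨x, rfl⟩
    exact (contDiffAt_ringInverse ℝ x).contDiffWithinAt
  refine (hf.comp Units.isOpen hC hu).congr_deriv (Eventually.of_forall fun t ht => ?_)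
  obtain ⟨x, hx⟩ := hu t ht
  rw [← hx, (hasFDerivAt_ringInverse (𝕜 := ℝ) x).fderiv, Ring.inverse_unit]
  simp [mul_assoc]

lemma exists_isOpen_integral_norm_le {F : Type*} [NormedAddCommGroup F] {a b : ℝ} {g : ℝ → F}
    (hab : a ≤ b) (hg : IntervalIntegrable g volume a b) (t : ℝ) {ε : ℝ} (hε : 0 < ε) :
    ∃ U : Set ℝ, IsOpen U ∧ t ∈ U ∧ ∀ s e, a ≤ s → s ≤ e → e ≤ b → Icc s e ⊆ U →
      ∫ τ in s..e, ‖g τ‖ ≤ ε := by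
  set k : ℝ → ℝ := (Ioc a b).indicator fun τ => ‖g τ‖
  have hk : Integrable k := by
    rw [integrable_indicator_iff measurableSet_Ioc]
    exact ((intervalIntegrable_iff_integrableOn_Ioc_of_le hab).1 hg).norm
  have hki : ∀ x y, IntervalIntegrable k volume x y := fun x y => hk.intervalIntegrable
  have hc : Continuous fun τ => ∫ x in t..τ, k x := intervalIntegral.continuous_primitive hki t
  refine ⟨{τ | |∫ x in t..τ, k x| < ε / 2}, isOpen_lt hc.abs continuous_const, by simpa, ?_⟩
  intro s e has hse heb hU
  have hs : |∫ x in t..s, k x| < ε / 2 := hU ⟨le_rfl, hse⟩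
  have he : |∫ x in t..e, k x| < ε / 2 := hU ⟨hse, le_rfl⟩
  have hgk : ∫ τ in s..e, ‖g τ‖ = ∫ x in s..e, k x := by
    refine intervalIntegral.integral_congr_ae (Eventually.of_forall fun x hx => ?_)
    rw [uIoc_of_le hse] at hx
    exact (indicator_of_mem (show x ∈ Ioc a b from
      ⟨has.trans_lt hx.1, hx.2.trans heb⟩) fun τ => ‖g τ‖).symm
  rw [hgk, ← intervalIntegral.integral_interval_sub_left (hki t e) (hki t s)]
  rw [abs_lt] at hs he
  linarith

lemma exists_Icc_mem_nhdsWithin_mapsTo {X : Type*} [TopologicalSpace X] {γ : ℝ → X}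
    (hγ : ContinuousOn γ (Icc 0 1)) {t : ℝ} (ht : t ∈ Icc (0 : ℝ) 1) {S : Set X}
    (hS : S ∈ 𝓝 (γ t)) :
    ∃ s e, 0 ≤ s ∧ s < e ∧ e ≤ 1 ∧ Icc s e ∈ 𝓝[Icc 0 1] t ∧ MapsTo γ (Icc s e) S := by
  obtain ⟨r, hr, hball⟩ := Metric.mem_nhdsWithin_iff.1 (hγ t ht hS)
  have hr2 : 0 < r / 2 := half_pos hr
  have hIcc : Icc (max 0 (t - r / 2)) (min 1 (t + r / 2)) =
      Metric.closedBall t (r / 2) ∩ Icc 0 1 := by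
    rw [Real.closedBall_eq_Icc, Icc_inter_Icc, max_comm, min_comm]
  refine ⟨max 0 (t - r / 2), min 1 (t + r / 2), le_max_left _ _, ?_, min_le_left _ _, ?_, ?_⟩
  · exact max_lt (lt_min one_pos (by linarith [ht.1])) (lt_min (by linarith [ht.2]) (by linarith))
  · rw [hIcc]
    exact inter_mem (mem_nhdsWithin_of_mem_nhds (Metric.closedBall_mem_nhds t hr2))
      self_mem_nhdsWithin
  · rw [hIcc]
    exact fun τ hτ => hball ⟨Metric.closedBall_subset_ball (half_lt_self hr) hτ.1, hτ.2⟩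

section Curves

variable {d : ℕ} {M : Type*} [TopologicalSpace M] [ChartedSpace (EuclideanSpace ℝ (Fin d)) M]
  {φ : OpenPartialHomeomorph M (EuclideanSpace ℝ (Fin d))} {γ : ℝ → M} {s e : ℝ}

lemma IsH1Curve.hasLpDerivOn (hγ : IsH1Curve d γ) (hφ : φ ∈ charts d M) (hs : 0 ≤ s)
    (hse : s ≤ e) (he : e ≤ 1) (hm : MapsTo γ (Icc s e) φ.source) :
    HasLpDerivOn 2 s e (fun t => φ (γ t)) (deriv fun t => φ (γ t)) :=
  (hγ.2 φ hφ s e hs hse he hm).hasLpDerivOn_deriv hse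

lemma IsH1Curve.ae_mfderiv_velocity (hγ : IsH1Curve d γ) (hφ : φ ∈ charts d M) (hs : 0 ≤ s)
    (hse : s ≤ e) (he : e ≤ 1) (hm : MapsTo γ (Icc s e) φ.source) :
    ∀ᵐ t, t ∈ Icc s e →
      mfderiv (𝓡 d) (𝓡 d) φ (γ t) (velocity d γ t) = deriv (fun τ => φ (γ τ)) t := by
  filter_upwards [(hγ.hasLpDerivOn hφ hs hse he hm).ae_hasDerivAt, ae_mem_Ioo_of_mem_Icc s e]
    with t hderiv hIoo ht
  have hmem : Icc (0 : ℝ) 1 ∈ 𝓝 t :=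
    Icc_mem_nhds (hs.trans_lt (hIoo ht).1) ((hIoo ht).2.trans_le he)
  exact mfderiv_velocity hφ (hγ.1.continuousAt hmem) (hm ht) (hderiv ht)

lemma IsH1Curve.ae_form_velocity (hγ : IsH1Curve d γ) (hφ : φ ∈ charts d M) (hs : 0 ≤ s)
    (hse : s ≤ e) (he : e ≤ 1) (hm : MapsTo γ (Icc s e) φ.source) {N : ℕ}
    (θ : ∀ x : M, TangentSpace (𝓡 d) x →L[ℝ] Mat N) :
    ∀ᵐ t, t ∈ Icc s e →
      θ (γ t) (velocity d γ t) = formCoord φ θ (φ (γ t)) (deriv (fun τ => φ (γ τ)) t) := by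
  filter_upwards [hγ.ae_mfderiv_velocity hφ hs hse he hm] with t hv ht
  exact (formCoord_mfderiv hφ θ (hm ht) _).symm.trans
    (congrArg (formCoord φ θ (φ (γ t))) (hv ht))

lemma IsH1Curve.hasLpDerivOn_comp (hγ : IsH1Curve d γ) (hφ : φ ∈ charts d M) (hs : 0 ≤ s)
    (hse : s ≤ e) (he : e ≤ 1) {F : Type*} [NormedAddCommGroup F] [NormedSpace ℝ F] {f : M → F}
    {S : Set M} (hS : IsOpen S) (hf : ContMDiffOn (𝓡 d) 𝓘(ℝ, F) ∞ f S)
    (hm : MapsTo γ (Icc s e) (φ.source ∩ S)) :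
    HasLpDerivOn 2 s e (fun t => f (γ t)) (fun t => mvfderiv (𝓡 d) f (γ t) (velocity d γ t)) := by
  have hmφ : MapsTo γ (Icc s e) φ.source := fun t ht => (hm ht).1
  refine (((hγ.hasLpDerivOn hφ hs hse he hmφ).comp (φ.isOpen_inter_preimage_symm hS)
    ((contDiffOn_comp_symm hf hφ).of_le (by simp)) fun t ht =>
    mem_target_inter_preimage_symm (hm ht).1 (hm ht).2).congr fun t ht =>
      congrArg f (φ.left_inv (hm ht).1)).congr_deriv ?_
  filter_upwards [hγ.ae_mfderiv_velocity hφ hs hse he hmφ] with t hv ht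
  rw [← hv ht]
  exact fderiv_comp_symm_mfderiv hφ (hm ht).1
    ((hf.contMDiffAt (hS.mem_nhds (hm ht).2)).mdifferentiableAt (by simp)) _

end Curves

section Frames

variable {d : ℕ} {M : Type*} [TopologicalSpace M] [ChartedSpace (EuclideanSpace ℝ (Fin d)) M]
  {N : ℕ} {G : Subgroup (Matrix.specialUnitaryGroup (Fin N) ℂ)}
  {E : M → Type*} [∀ x, AddCommGroup (E x)] [∀ x, Module ℂ (E x)]

namespace GBundle

variable (B : GBundle d G E) {γ : ℝ → M}

/-- The matrix in the trivialization `ψ_a` of a frame `T t : ℂ^N ≅ E_{γ(t)}` along a curve. -/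
def frameMatrix (T : ∀ t, (Fin N → ℂ) ≃ₗ[ℂ] E (γ t)) (a : B.ι) (t : ℝ) : Mat N :=
  LinearMap.toMatrix' ((B.ψ a (γ t)).toLinearMap ∘ₗ (T t).toLinearMap)

lemma transition_mul_frameMatrix (T : ∀ t, (Fin N → ℂ) ≃ₗ[ℂ] E (γ t)) (a b : B.ι) (t : ℝ) :
    B.transition b a (γ t) * B.frameMatrix T a t = B.frameMatrix T b t := by
  rw [frameMatrix, transition, frameMatrix, ← LinearMap.toMatrix'_comp]
  congr 1
  ext v
  simp

lemma isUnit_frameMatrix (T : ∀ t, (Fin N → ℂ) ≃ₗ[ℂ] E (γ t)) (a : B.ι) (t : ℝ) :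
    IsUnit (B.frameMatrix T a t) := by
  rw [Matrix.isUnit_iff_isUnit_det, frameMatrix, LinearMap.det_toMatrix']
  exact LinearEquiv.isUnit_det' ((T t).trans (B.ψ a (γ t)))

lemma matrixOf_frame_comp_symm (T : ∀ t, (Fin N → ℂ) ≃ₗ[ℂ] E (γ t)) (a : B.ι) (t s : ℝ) :
    B.matrixOf a a ((T t).toLinearMap ∘ₗ (T s).symm.toLinearMap)
      = B.frameMatrix T a t * Ring.inverse (B.frameMatrix T a s) := by
  rw [← Ring.mul_inverse_cancel_right _ (B.matrixOf a a _) (B.isUnit_frameMatrix T a s)]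
  congr 1
  rw [frameMatrix, frameMatrix, matrixOf, ← LinearMap.toMatrix'_comp]
  congr 1
  ext v
  simp

lemma exists_frameMatrix_eq (a : B.ι) {I : Set ℝ} {u : ℝ → Mat N}
    (hu : ∀ t ∈ I, IsUnit (u t)) :
    ∃ T : ∀ t, (Fin N → ℂ) ≃ₗ[ℂ] E (γ t), EqOn (B.frameMatrix T a) u I := by
  have hT (t : ℝ) : ∃ S : (Fin N → ℂ) ≃ₗ[ℂ] E (γ t),
      t ∈ I → LinearMap.toMatrix' ((B.ψ a (γ t)).toLinearMap ∘ₗ S.toLinearMap) = u t := by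
    by_cases ht : t ∈ I
    · obtain ⟨w, huw, hwu⟩ := isUnit_iff_exists.1 (hu t ht)
      refine ⟨(Matrix.toLin'OfInv hwu huw).trans (B.ψ a (γ t)).symm, fun _ => ?_⟩
      refine (congrArg LinearMap.toMatrix' (LinearMap.ext fun v => ?_)).trans
        (LinearMap.toMatrix'_toLin' (u t))
      simp only [LinearMap.comp_apply, LinearEquiv.coe_coe, LinearEquiv.trans_apply,
        LinearEquiv.apply_symm_apply]
      rfl
    · exact ⟨(B.ψ a (γ t)).symm, fun h => absurd h ht⟩
  choose T hT using hT
  exact ⟨T, hT⟩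

end GBundle

namespace Connection

variable {B : GBundle d G E} (A : Connection B) {γ : ℝ → M} {s e : ℝ}

/-- The frame `T` along `γ` is horizontal on `[s,e]`: in each trivialization its matrix `T^a` is an
`H¹` solution of `d/dt T^a = -A^a_μ(γ(t)) γ̇^μ(t) T^a`. -/
def IsHorizontal (γ : ℝ → M) (s e : ℝ) (T : ∀ t, (Fin N → ℂ) ≃ₗ[ℂ] E (γ t)) : Prop :=
  ∀ a : B.ι, ∀ s₀ t₀ : ℝ, s ≤ s₀ → s₀ ≤ t₀ → t₀ ≤ e → MapsTo γ (Icc s₀ t₀) (B.W a) →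
    HasLpDerivOn 2 s₀ t₀ (B.frameMatrix T a)
      (fun t => -(A.A a (γ t) (velocity d γ t) * B.frameMatrix T a t))

section Horizontal

variable {A} {T T' : ∀ t, (Fin N → ℂ) ≃ₗ[ℂ] E (γ t)}

lemma IsHorizontal.congr (h : A.IsHorizontal γ s e T) (hT : ∀ t ∈ Icc s e, T t = T' t) :
    A.IsHorizontal γ s e T' := by
  intro a s₀ t₀ hs h₀ ht hm
  have hf : EqOn (B.frameMatrix T a) (B.frameMatrix T' a) (Icc s₀ t₀) := fun t htt => by
    rw [GBundle.frameMatrix, GBundle.frameMatrix, hT t ⟨hs.trans htt.1, htt.2.trans ht⟩]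
  exact ((h a s₀ t₀ hs h₀ ht hm).congr hf).congr_deriv
    (Eventually.of_forall fun t htt => by rw [hf htt])

lemma IsHorizontal.trans_const (h : A.IsHorizontal γ s e T)
    (C : (Fin N → ℂ) ≃ₗ[ℂ] (Fin N → ℂ)) : A.IsHorizontal γ s e (fun t => C.trans (T t)) := by
  intro a s₀ t₀ hs h₀ ht hm
  have hf : B.frameMatrix (fun t => C.trans (T t)) a
      = fun t => B.frameMatrix T a t * LinearMap.toMatrix' C.toLinearMap := funext fun t => by
    rw [GBundle.frameMatrix, GBundle.frameMatrix, ← LinearMap.toMatrix'_comp]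
    rfl
  rw [hf]
  refine ((h a s₀ t₀ hs h₀ ht hm).mul_const _).congr_deriv (Eventually.of_forall fun t _ => ?_)
  rw [neg_mul, mul_assoc]

lemma IsHorizontal.glue {m : ℝ} (h₁ : A.IsHorizontal γ s m T) (h₂ : A.IsHorizontal γ m e T) :
    A.IsHorizontal γ s e T := by
  intro a s₀ t₀ hs h₀ ht hm
  rcases le_total t₀ m with htm | hmt
  · exact h₁ a s₀ t₀ hs h₀ htm hm
  rcases le_total m s₀ with hms | hsm
  · exact h₂ a s₀ t₀ hms h₀ ht hm
  exact (h₁ a s₀ m hs hsm le_rfl (hm.mono_left (Icc_subset_Icc_right hmt))).glue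
    (h₂ a m t₀ le_rfl hmt ht (hm.mono_left (Icc_subset_Icc_left hsm)))

lemma exists_isHorizontal_glue {m : ℝ} (h₁ : ∃ T, A.IsHorizontal γ s m T)
    (h₂ : ∃ T, A.IsHorizontal γ m e T) : ∃ T, A.IsHorizontal γ s e T := by
  obtain ⟨T₁, h₁⟩ := h₁
  obtain ⟨T₂, h₂⟩ := h₂
  set C := (T₁ m).trans (T₂ m).symm
  classical
  refine ⟨fun t => if t ≤ m then T₁ t else C.trans (T₂ t), IsHorizontal.glue (m := m) ?_ ?_⟩
  · exact h₁.congr fun t ht => (if_pos ht.2).symm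
  · refine (h₂.trans_const C).congr fun t ht => ?_
    rcases ht.1.eq_or_lt with rfl | hlt
    · ext v
      simp [C]
    · rw [if_neg hlt.not_ge]

end Horizontal

section LocalExistence

variable {φ : OpenPartialHomeomorph M (EuclideanSpace ℝ (Fin d))} {a : B.ι}

lemma memLp_form_velocity (hγ : IsH1Curve d γ) (hφ : φ ∈ charts d M) (hs : 0 ≤ s) (hse : s ≤ e)
    (he : e ≤ 1) (hm : MapsTo γ (Icc s e) (φ.source ∩ B.W a)) :
    MemLp (fun t => A.A a (γ t) (velocity d γ t)) 2 (volume.restrict (Icc s e)) := by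
  have hmφ : MapsTo γ (Icc s e) φ.source := fun t ht => (hm ht).1
  have hx := hγ.hasLpDerivOn hφ hs hse he hmφ
  have hcoef : ContinuousOn (fun t => formCoord φ (A.A a) (φ (γ t))) (Icc s e) :=
    (A.smooth a φ hφ).continuousOn.comp hx.continuousOn fun t ht =>
      mem_target_inter_preimage_symm (hm ht).1 (hm ht).2
  refine (memLp_clm_apply hcoef hx.memLp).ae_eq ((ae_restrict_iff' measurableSet_Icc).2 ?_)
  exact (hγ.ae_form_velocity hφ hs hse he hmφ (A.A a)).mono fun t h ht => (h ht).symm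

lemma hasLpDerivOn_transition (hγ : IsH1Curve d γ) (hφ : φ ∈ charts d M) (hs : 0 ≤ s)
    (hse : s ≤ e) (he : e ≤ 1) {b : B.ι}
    (hm : MapsTo γ (Icc s e) (φ.source ∩ (B.W b ∩ B.W a))) :
    HasLpDerivOn 2 s e (fun t => B.transition b a (γ t)) (fun t =>
      B.transition b a (γ t) * A.A a (γ t) (velocity d γ t)
        - A.A b (γ t) (velocity d γ t) * B.transition b a (γ t)) := by
  refine (hγ.hasLpDerivOn_comp hφ hs hse he ((B.isOpen_W b).inter (B.isOpen_W a))
    (B.transition_smooth b a) hm).congr_deriv (Eventually.of_forall fun t ht => ?_)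
  rw [A.transition_mul_form (hm ht).2, add_sub_cancel_left]
  rfl

lemma isHorizontal_of_hasLpDerivOn (hγ : IsH1Curve d γ) (hφ : φ ∈ charts d M) (hs : 0 ≤ s)
    (he : e ≤ 1) (hm : MapsTo γ (Icc s e) (φ.source ∩ B.W a))
    {T : ∀ t, (Fin N → ℂ) ≃ₗ[ℂ] E (γ t)} (hT : HasLpDerivOn 2 s e (B.frameMatrix T a)
      (fun t => -(A.A a (γ t) (velocity d γ t) * B.frameMatrix T a t))) :
    A.IsHorizontal γ s e T := by
  intro b s₀ t₀ hs₀ h₀ ht₀ hmb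
  have hsub : Icc s₀ t₀ ⊆ Icc s e := Icc_subset_Icc hs₀ ht₀
  have hg := A.hasLpDerivOn_transition hγ hφ (hs.trans hs₀) h₀ (ht₀.trans he) (a := a) (b := b)
    fun t ht => ⟨(hm (hsub ht)).1, hmb ht, (hm (hsub ht)).2⟩
  refine ((hg.mul (hT.mono hs₀ h₀ ht₀)).congr fun t _ =>
    B.transition_mul_frameMatrix T a b t).congr_deriv (Eventually.of_forall fun t _ => ?_)
  rw [← B.transition_mul_frameMatrix T a b t]
  noncomm_ring

lemma exists_isHorizontal_of_integral_le (hγ : IsH1Curve d γ) (hφ : φ ∈ charts d M) (hs : 0 ≤ s)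
    (hse : s ≤ e) (he : e ≤ 1) (hm : MapsTo γ (Icc s e) (φ.source ∩ B.W a))
    (hsmall : ∫ t in s..e, ‖A.A a (γ t) (velocity d γ t)‖ ≤ 1 / 4) :
    ∃ T, A.IsHorizontal γ s e T := by
  have hone : ‖(1 : Mat N)‖ ≤ 1 := by
    rcases subsingleton_or_nontrivial (Mat N) with h | h
    · rw [Subsingleton.elim (1 : Mat N) 0, norm_zero]
      exact zero_le_one
    · exact CStarRing.norm_one.le
  obtain ⟨u, hu, hunit⟩ := exists_isUnit_linear_solution hone hse
    (A.memLp_form_velocity hγ hφ hs hse he hm) hsmall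
  obtain ⟨T, hT⟩ := B.exists_frameMatrix_eq (γ := γ) a hunit
  refine ⟨T, A.isHorizontal_of_hasLpDerivOn hγ hφ hs he hm ((hu.congr hT.symm).congr_deriv
    (Eventually.of_forall fun t ht => by rw [hT ht]))⟩

end LocalExistence

variable [IsManifold (𝓡 d) ∞ M]

lemma exists_isHorizontal (hγ : IsH1Curve d γ) : ∃ T, A.IsHorizontal γ 0 1 T := by
  refine interval_induction zero_le_one (Q := fun s e => ∃ T, A.IsHorizontal γ s e T) ?_
    fun s m e _ _ _ _ h₁ h₂ => exists_isHorizontal_glue h₁ h₂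
  intro t ht
  obtain ⟨a, ha⟩ := B.cover (γ t)
  obtain ⟨φ, hφ, htφ, hφa⟩ := exists_chart_subset (d := d) (γ t) (B.isOpen_W a) ha
  obtain ⟨s₁, e₁, hs₁, hse₁, he₁, hmem, hmφ⟩ :=
    exists_Icc_mem_nhdsWithin_mapsTo hγ.1 ht (φ.open_source.mem_nhds htφ)
  have hm : MapsTo γ (Icc s₁ e₁) (φ.source ∩ B.W a) := fun τ hτ => ⟨hmφ hτ, hφa (hmφ hτ)⟩
  obtain ⟨U, hU, htU, hsmall⟩ := exists_isOpen_integral_norm_le hse₁.le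
    ((intervalIntegrable_iff_memLp_one hse₁.le).2
      ((A.memLp_form_velocity hγ hφ hs₁ hse₁.le he₁ hm).mono_exponent one_le_two)) t
    (show (0 : ℝ) < 1 / 4 by norm_num)
  obtain ⟨V, hV, htV, hVsub⟩ := mem_nhdsWithin.1 hmem
  refine ⟨U ∩ V, hU.inter hV, ⟨htU, htV⟩, fun s e hs hse he hsub => ?_⟩
  have hs' : s ∈ Icc s₁ e₁ := hVsub ⟨(hsub ⟨le_rfl, hse⟩).2, hs, hse.trans he⟩
  have he' : e ∈ Icc s₁ e₁ := hVsub ⟨(hsub ⟨hse, le_rfl⟩).2, hs.trans hse, he⟩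
  exact A.exists_isHorizontal_of_integral_le hγ hφ hs hse he
    (hm.mono_left (Icc_subset_Icc hs'.1 he'.2))
    (hsmall s e hs'.1 hse he'.2 (hsub.trans inter_subset_left))

lemma exists_isParallelTransport (hγ : IsH1Curve d γ) :
    ∃ U : ∀ t s : ℝ, E (γ s) →ₗ[ℂ] E (γ t), A.IsParallelTransport γ U := by
  obtain ⟨T, hT⟩ := A.exists_isHorizontal hγ
  refine ⟨fun t s => (T t).toLinearMap ∘ₗ (T s).symm.toLinearMap, fun t _ s _ r _ => ?_,
    fun s _ => ?_, fun a s₀ t₀ h₀ h h₁ hm s _ => ?_, fun a s₀ t₀ h₀ h h₁ hm t _ => ?_⟩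
  · ext v
    simp
  · ext v
    simp
  · have hU := ((hT a s₀ t₀ h₀ h h₁ hm).mul_const
      (Ring.inverse (B.frameMatrix T a s))).congr_deriv
      (g' := fun t => -(A.A a (γ t) (velocity d γ t)) *
        (B.frameMatrix T a t * Ring.inverse (B.frameMatrix T a s)))
      (Eventually.of_forall fun t _ => by noncomm_ring)
    simp only [B.matrixOf_frame_comp_symm]
    exact ⟨hU.isH1On, (ae_restrict_iff' measurableSet_Icc).2 hU.ae_hasDerivAt⟩
  · have hU := (((hT a s₀ t₀ h₀ h h₁ hm).ringInverse_solution fun s _ =>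
      B.isUnit_frameMatrix T a s).const_mul (B.frameMatrix T a t)).congr_deriv
      (g' := fun s => B.frameMatrix T a t * Ring.inverse (B.frameMatrix T a s) *
        A.A a (γ s) (velocity d γ s))
      (Eventually.of_forall fun s _ => by noncomm_ring)
    simp only [B.matrixOf_frame_comp_symm]
    exact ⟨hU.isH1On, (ae_restrict_iff' measurableSet_Icc).2 hU.ae_hasDerivAt⟩

lemma isParallelTransport_parallelTransport (hγ : IsH1Curve d γ) :
    A.IsParallelTransport γ (A.parallelTransport γ) := by
  have h := A.exists_isParallelTransport hγ
  rw [parallelTransport, dif_pos h]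
  exact h.choose_spec

end Connection

end Frames

/-! ### First derivatives of functions on the space of curves -/

lemma HasH1FDerivAt.hasFDerivAt_eval {V P : Type*} [NormedAddCommGroup V] [NormedSpace ℝ V]
    [CompleteSpace V] [NormedAddCommGroup P] [NormedSpace ℝ P] {s e : ℝ} {y : P → ℝ → V}
    {ξ : P →ₗ[ℝ] (ℝ → V)} {p₀ : P} (h : HasH1FDerivAt s e y ξ p₀) {t : ℝ} (ht : t ∈ Icc s e) :
    HasFDerivAt (fun p => y p t) (h.isBoundedLinearMap_eval ht).toContinuousLinearMap p₀ :=
  .of_isLittleO <| Asymptotics.isLittleO_iff.2 fun _ hc =>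
    (h.eventually_norm_remainder_le hc).mono fun _ hp => hp.1 t ht

section FirstDeriv

variable {d : ℕ} {M : Type*} [TopologicalSpace M] [ChartedSpace (EuclideanSpace ℝ (Fin d)) M]

/-- `fieldCoord` as a linear map. -/
def fieldCoordLinear (φ : OpenPartialHomeomorph M (EuclideanSpace ℝ (Fin d))) (γ : ℝ → M) :
    (∀ t : ℝ, TangentSpace (𝓡 d) (γ t)) →ₗ[ℝ] (ℝ → EuclideanSpace ℝ (Fin d)) where
  toFun := fieldCoord φ γ
  map_add' X Y := funext fun t => map_add (mfderiv (𝓡 d) (𝓡 d) φ (γ t)) (X t) (Y t)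
  map_smul' c X := funext fun t => map_smul (mfderiv (𝓡 d) (𝓡 d) φ (γ t)) c (X t)

variable {γ : CurveSpace d M}

section Variation

variable {P : Type*} [NormedAddCommGroup P] [NormedSpace ℝ P] {Γ : P → CurveSpace d M}
  {X : P →ₗ[ℝ] (∀ t : ℝ, TangentSpace (𝓡 d) (γ.1 t))} {p₀ : P}

lemma HasVariationAt.hasH1FDerivAt (h : HasVariationAt γ Γ X p₀)
    {φ : OpenPartialHomeomorph M (EuclideanSpace ℝ (Fin d))} (hφ : φ ∈ charts d M) {s e : ℝ}
    (hs : 0 ≤ s) (hse : s < e) (he : e ≤ 1) (hm : MapsTo γ.1 (Icc s e) φ.source) :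
    HasH1FDerivAt s e (fun p t => φ ((Γ p).1 t)) (fieldCoordLinear φ γ.1 ∘ₗ X) p₀ where
  lt := hse
  near := (h.mapsTo φ hφ s e hs hse.le he hm).mono fun p hp =>
    (Γ p).2.hasLpDerivOn hφ hs hse.le he hp
  tangent p := (h.tangent p φ hφ s e hs hse.le he hm).hasLpDerivOn_deriv hse.le
  bounded := h.bounded φ hφ s e hs hse.le he hm
  isLittleO := by
    simp only [h.base]
    exact h.isLittleO φ hφ s e hs hse.le he hm

lemma HasVariationAt.exists_hasFDerivAt_chart (h : HasVariationAt γ Γ X p₀)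
    {φ : OpenPartialHomeomorph M (EuclideanSpace ℝ (Fin d))} (hφ : φ ∈ charts d M) {t : ℝ}
    (ht : t ∈ Icc (0 : ℝ) 1) (htφ : γ.1 t ∈ φ.source) :
    ∃ D : P →L[ℝ] EuclideanSpace ℝ (Fin d), (∀ p, D p = fieldCoord φ γ.1 (X p) t) ∧
      HasFDerivAt (fun p => φ ((Γ p).1 t)) D p₀ ∧ ∀ᶠ p in 𝓝 p₀, (Γ p).1 t ∈ φ.source := by
  obtain ⟨s, e, hs, hse, he, hmem, hm⟩ :=
    exists_Icc_mem_nhdsWithin_mapsTo γ.2.1 ht (φ.open_source.mem_nhds htφ)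
  have hst : t ∈ Icc s e := mem_of_mem_nhdsWithin ht hmem
  exact ⟨_, fun p => rfl, (h.hasH1FDerivAt hφ hs hse he hm).hasFDerivAt_eval hst,
    (h.mapsTo φ hφ s e hs hse.le he hm).mono fun p hp => hp hst⟩

end Variation

lemma HasFirstDerivAt.congr_deriv {V : Type*} [NormedAddCommGroup V] [NormedSpace ℝ V]
    {f : CurveSpace d M → V} {L L' : (∀ t : ℝ, TangentSpace (𝓡 d) (γ.1 t)) → V}
    (h : HasFirstDerivAt f γ L) (hL : ∀ X, IsH1Field γ.1 X → L X = L' X) :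
    HasFirstDerivAt f γ L' := by
  intro P _ _ Γ X p₀ hΓ
  obtain ⟨D, hD, hf⟩ := h P Γ X p₀ hΓ
  exact ⟨D, fun p => (hD p).trans (hL _ (hΓ.tangent p)), hf⟩

lemma hasFirstDerivAt_const {V : Type*} [NormedAddCommGroup V] [NormedSpace ℝ V] (c : V) :
    HasFirstDerivAt (fun _ : CurveSpace d M => c) γ (fun _ => 0) :=
  fun _ _ _ _ _ p₀ _ => ⟨0, fun _ => rfl, hasFDerivAt_const c p₀⟩

lemma HasFirstDerivAt.mul {𝔸 : Type*} [NormedRing 𝔸] [NormedAlgebra ℝ 𝔸]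
    {f g : CurveSpace d M → 𝔸} {L L' : (∀ t : ℝ, TangentSpace (𝓡 d) (γ.1 t)) → 𝔸}
    (hf : HasFirstDerivAt f γ L) (hg : HasFirstDerivAt g γ L') :
    HasFirstDerivAt (fun σ => f σ * g σ) γ (fun X => L X * g γ + f γ * L' X) := by
  intro P _ _ Γ X p₀ hΓ
  obtain ⟨D, hD, hf⟩ := hf P Γ X p₀ hΓ
  obtain ⟨D', hD', hg⟩ := hg P Γ X p₀ hΓ
  refine ⟨_, fun p => ?_, hf.mul' hg⟩
  simp [hΓ.base, hD, hD', add_comm]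

lemma hasFirstDerivAt_eval [IsManifold (𝓡 d) ∞ M] {V : Type*} [NormedAddCommGroup V]
    [NormedSpace ℝ V] {f : M → V} {S : Set M} (hS : IsOpen S)
    (hf : ContMDiffOn (𝓡 d) 𝓘(ℝ, V) ∞ f S) {t : ℝ} (ht : t ∈ Icc (0 : ℝ) 1) (htS : γ.1 t ∈ S) :
    HasFirstDerivAt (fun σ : CurveSpace d M => f (σ.1 t)) γ
      (fun X => mvfderiv (𝓡 d) f (γ.1 t) (X t)) := by
  intro P _ _ Γ X p₀ hΓ
  obtain ⟨φ, hφ, htφ, -⟩ := exists_chart_subset (d := d) (γ.1 t) hS htS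
  obtain ⟨D, hD, hDeriv, hsource⟩ := hΓ.exists_hasFDerivAt_chart hφ ht htφ
  have hfφ : HasFDerivAt (fun y => f (φ.symm y))
      (fderiv ℝ (fun y => f (φ.symm y)) (φ (γ.1 t))) (φ ((Γ p₀).1 t)) := by
    rw [hΓ.base]
    exact (((contDiffOn_comp_symm hf hφ).contDiffAt
      ((φ.isOpen_inter_preimage_symm hS).mem_nhds
        (mem_target_inter_preimage_symm htφ htS))).differentiableAt (by simp)).hasFDerivAt
  refine ⟨_, fun p => ?_, (hfφ.comp p₀ hDeriv).congr_of_eventuallyEq ?_⟩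
  · rw [ContinuousLinearMap.comp_apply, hD]
    exact fderiv_comp_symm_mfderiv hφ htφ
      ((hf.contMDiffAt (hS.mem_nhds htS)).mdifferentiableAt (by simp)) _
  · filter_upwards [hsource] with p hp
    exact congrArg f (φ.left_inv hp).symm

end FirstDeriv

/-! ### The first derivative of the parallel transport -/

lemma intervalIntegral_mul_mul_const {𝔸 : Type*} [NormedRing 𝔸] [NormedAlgebra ℝ 𝔸]
    [CompleteSpace 𝔸] {f : ℝ → 𝔸} {c e : ℝ} (hf : IntervalIntegrable f volume c e) (P Q : 𝔸) :
    ∫ t in c..e, P * f t * Q = P * (∫ t in c..e, f t) * Q := by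
  simpa only [ContinuousLinearMap.mulLeftRight_apply]
    using (ContinuousLinearMap.mulLeftRight ℝ 𝔸 P Q).intervalIntegral_comp_comm hf

section TransportDerivative

variable {d : ℕ} {M : Type*} [TopologicalSpace M] [ChartedSpace (EuclideanSpace ℝ (Fin d)) M]
  {N : ℕ} {G : Subgroup (Matrix.specialUnitaryGroup (Fin N) ℂ)}
  {E : M → Type*} [∀ x, AddCommGroup (E x)] [∀ x, Module ℂ (E x)] {B : GBundle d G E}

namespace Connection

variable (A : Connection B)

/-- The integrand `U_{e,t} F(X, γ̇) U_{t,c}` of the derivative of `U_{e,c}`, as a matrix in the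
trivializations `ψ_a` at `γ c` and `ψ_b` at `γ e`. -/
def transportedCurvature (γ : CurveSpace d M) (c e : ℝ) (a b : B.ι)
    (X : ∀ t : ℝ, TangentSpace (𝓡 d) (γ.1 t)) (t : ℝ) : Mat N :=
  B.matrixOf b a (A.parallelTransport γ.1 e t ∘ₗ
    A.curvature (γ.1 t) (X t) (velocity d γ.1 t) ∘ₗ A.parallelTransport γ.1 t c)

/-- The matrix `ψ_b U_{e,c}(σ) ψ_a⁻¹` as a function of the curve `σ`. -/
def transportMatrix (c e : ℝ) (a b : B.ι) (σ : CurveSpace d M) : Mat N :=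
  B.matrixOf b a (A.parallelTransport σ.1 e c)

/-- The derivative formula for `U_{e,c}` at `γ` in the trivializations `ψ_a` and `ψ_b`. -/
structure HasTransportDeriv (γ : CurveSpace d M) (c e : ℝ) (a b : B.ι) : Prop where
  integrable : ∀ X, IsH1Field γ.1 X →
    IntervalIntegrable (A.transportedCurvature γ c e a b X) volume c e
  hasDeriv : HasFirstDerivAt (A.transportMatrix c e a b) γ fun X =>
    -(∫ t in c..e, A.transportedCurvature γ c e a b X t)
      - A.A b (γ.1 e) (X e) * A.transportMatrix c e a b γ
      + A.transportMatrix c e a b γ * A.A a (γ.1 c) (X c)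

lemma transportMatrix_transition (c e : ℝ) (a b a' b' : B.ι) :
    A.transportMatrix c e a' b' = fun σ =>
      B.transition b' b (σ.1 e) * A.transportMatrix c e a b σ * B.transition a a' (σ.1 c) :=
  funext fun _ => B.matrixOf_eq _ _ _ _ _

variable {γ : CurveSpace d M}

lemma transportedCurvature_transition (c e : ℝ) (a b a' b' : B.ι)
    (X : ∀ t : ℝ, TangentSpace (𝓡 d) (γ.1 t)) :
    A.transportedCurvature γ c e a' b' X = fun t =>
      B.transition b' b (γ.1 e) * A.transportedCurvature γ c e a b X t
        * B.transition a a' (γ.1 c) :=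
  funext fun _ => B.matrixOf_eq _ _ _ _ _

lemma transportedCurvature_eq (c e : ℝ) (a b k : B.ι)
    (X : ∀ t : ℝ, TangentSpace (𝓡 d) (γ.1 t)) (t : ℝ) :
    A.transportedCurvature γ c e a b X t = A.transportMatrix t e k b γ
      * B.matrixOf k k (A.curvature (γ.1 t) (X t) (velocity d γ.1 t))
      * A.transportMatrix c t a k γ := by
  rw [transportedCurvature, B.matrixOf_comp a k b, B.matrixOf_comp a k k, ← mul_assoc]
  rfl

variable [IsManifold (𝓡 d) ∞ M]

lemma transportMatrix_self (σ : CurveSpace d M) {t : ℝ} (ht : t ∈ Icc (0 : ℝ) 1) (a : B.ι) :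
    A.transportMatrix t t a a σ = 1 := by
  rw [transportMatrix, (A.isParallelTransport_parallelTransport σ.2).init t ht, B.matrixOf_id,
    B.transition_self]

section Cocycle

variable {c m e t : ℝ}

lemma transportMatrix_mul (σ : CurveSpace d M) (hc : c ∈ Icc (0 : ℝ) 1)
    (hm : m ∈ Icc (0 : ℝ) 1) (he : e ∈ Icc (0 : ℝ) 1) (a k b : B.ι) :
    A.transportMatrix m e k b σ * A.transportMatrix c m a k σ = A.transportMatrix c e a b σ := by
  rw [transportMatrix, transportMatrix, ← B.matrixOf_comp,
    (A.isParallelTransport_parallelTransport σ.2).comp e he m hm c hc]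
  rfl

lemma transportMatrix_mul_transportedCurvature (hm : m ∈ Icc (0 : ℝ) 1)
    (he : e ∈ Icc (0 : ℝ) 1) (ht : t ∈ Icc (0 : ℝ) 1) (a k b : B.ι)
    (X : ∀ t : ℝ, TangentSpace (𝓡 d) (γ.1 t)) :
    A.transportMatrix m e k b γ * A.transportedCurvature γ c m a k X t
      = A.transportedCurvature γ c e a b X t := by
  rw [A.transportedCurvature_eq c e a b k, A.transportedCurvature_eq c m a k k,
    ← A.transportMatrix_mul γ ht hm he k k b]
  noncomm_ring

lemma transportedCurvature_mul_transportMatrix (hc : c ∈ Icc (0 : ℝ) 1)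
    (hm : m ∈ Icc (0 : ℝ) 1) (ht : t ∈ Icc (0 : ℝ) 1) (a k b : B.ι)
    (X : ∀ t : ℝ, TangentSpace (𝓡 d) (γ.1 t)) :
    A.transportedCurvature γ m e k b X t * A.transportMatrix c m a k γ
      = A.transportedCurvature γ c e a b X t := by
  rw [A.transportedCurvature_eq c e a b k, A.transportedCurvature_eq m e k b k,
    ← A.transportMatrix_mul γ hc hm ht a k k]
  noncomm_ring

end Cocycle

section Operations

variable {A} {c m e : ℝ} {a b k : B.ι}

lemma HasTransportDeriv.change_trivialization {a' b' : B.ι}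
    (h : A.HasTransportDeriv γ c e a b) (hc : c ∈ Icc (0 : ℝ) 1) (he : e ∈ Icc (0 : ℝ) 1)
    (ha : γ.1 c ∈ B.W a ∩ B.W a') (hb : γ.1 e ∈ B.W b' ∩ B.W b) :
    A.HasTransportDeriv γ c e a' b' := by
  have hstart : HasFirstDerivAt (fun σ : CurveSpace d M => B.transition a a' (σ.1 c)) γ
      (fun X => mvfderiv (𝓡 d) (B.transition a a') (γ.1 c) (X c)) :=
    hasFirstDerivAt_eval ((B.isOpen_W a).inter (B.isOpen_W a')) (B.transition_smooth a a') hc ha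
  have hend : HasFirstDerivAt (fun σ : CurveSpace d M => B.transition b' b (σ.1 e)) γ
      (fun X => mvfderiv (𝓡 d) (B.transition b' b) (γ.1 e) (X e)) :=
    hasFirstDerivAt_eval ((B.isOpen_W b').inter (B.isOpen_W b)) (B.transition_smooth b' b) he hb
  refine ⟨fun X hX => ?_, ?_⟩
  · rw [A.transportedCurvature_transition c e a b a' b']
    exact ((h.integrable X hX).const_mul _).mul_const _
  rw [A.transportMatrix_transition c e a b a' b']
  refine ((hend.mul h.hasDeriv).mul hstart).congr_deriv fun X hX => ?_
  rw [A.transportedCurvature_transition c e a b a' b',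
    intervalIntegral_mul_mul_const (h.integrable X hX),
    ← sub_eq_iff_eq_add'.2 (A.transition_mul_form hb (X e)),
    ← sub_eq_iff_eq_add'.2 (A.transition_mul_form ha (X c))]
  noncomm_ring

lemma HasTransportDeriv.trans (hc : 0 ≤ c) (hcm : c ≤ m) (hme : m ≤ e) (he : e ≤ 1)
    (h₁ : A.HasTransportDeriv γ c m a k) (h₂ : A.HasTransportDeriv γ m e k b) :
    A.HasTransportDeriv γ c e a b := by
  have hc' : c ∈ Icc (0 : ℝ) 1 := ⟨hc, hcm.trans (hme.trans he)⟩
  have hm' : m ∈ Icc (0 : ℝ) 1 := ⟨hc.trans hcm, hme.trans he⟩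
  have he' : e ∈ Icc (0 : ℝ) 1 := ⟨hc.trans (hcm.trans hme), he⟩
  have hF₁ (X) : EqOn (fun t => A.transportMatrix m e k b γ * A.transportedCurvature γ c m a k X t)
      (A.transportedCurvature γ c e a b X) (uIcc c m) := fun t ht =>
    A.transportMatrix_mul_transportedCurvature hm' he' (uIcc_subset_Icc hc' hm' ht) a k b X
  have hF₂ (X) : EqOn (fun t => A.transportedCurvature γ m e k b X t * A.transportMatrix c m a k γ)
      (A.transportedCurvature γ c e a b X) (uIcc m e) := fun t ht =>
    A.transportedCurvature_mul_transportMatrix hc' hm' (uIcc_subset_Icc hm' he' ht) a k b X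
  have hint₁ (X) (hX : IsH1Field γ.1 X) :
      IntervalIntegrable (A.transportedCurvature γ c e a b X) volume c m :=
    ((h₁.integrable X hX).const_mul _).congr ((hF₁ X).mono uIoc_subset_uIcc)
  have hint₂ (X) (hX : IsH1Field γ.1 X) :
      IntervalIntegrable (A.transportedCurvature γ c e a b X) volume m e :=
    ((h₂.integrable X hX).mul_const _).congr ((hF₂ X).mono uIoc_subset_uIcc)
  refine ⟨fun X hX => (hint₁ X hX).trans (hint₂ X hX), ?_⟩
  rw [← funext fun σ => A.transportMatrix_mul σ hc' hm' he' a k b]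
  refine (h₂.hasDeriv.mul h₁.hasDeriv).congr_deriv fun X hX => ?_
  have hI₁ := intervalIntegral_mul_mul_const (h₁.integrable X hX) (A.transportMatrix m e k b γ) 1
  have hI₂ := intervalIntegral_mul_mul_const (h₂.integrable X hX) 1 (A.transportMatrix c m a k γ)
  simp only [mul_one, one_mul] at hI₁ hI₂
  rw [← intervalIntegral.integral_add_adjacent_intervals (hint₁ X hX) (hint₂ X hX),
    ← intervalIntegral.integral_congr (hF₁ X), ← intervalIntegral.integral_congr (hF₂ X), hI₁, hI₂]
  noncomm_ring

end Operations

section Local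

variable {φ : OpenPartialHomeomorph M (EuclideanSpace ℝ (Fin d))} {a : B.ι} {s e : ℝ}

lemma hasLpDerivOn_transportMatrix (σ : CurveSpace d M) (hφ : φ ∈ charts d M) (hs : 0 ≤ s)
    (hse : s ≤ e) (he : e ≤ 1) (hm : MapsTo σ.1 (Icc s e) (φ.source ∩ B.W a)) :
    HasLpDerivOn 2 s e (fun t => A.transportMatrix s t a a σ) fun t =>
      -(formCoord φ (A.A a) (φ (σ.1 t)) (deriv (fun τ => φ (σ.1 τ)) t)
        * A.transportMatrix s t a a σ) := by
  obtain ⟨hH1, hderiv⟩ := (A.isParallelTransport_parallelTransport σ.2).deriv_fst a s e hs hse he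
    (fun _ ht => (hm ht).2) s ⟨le_rfl, hse⟩
  refine (hH1.hasLpDerivOn hse ((ae_restrict_iff' measurableSet_Icc).1 hderiv)).congr_deriv ?_
  filter_upwards [σ.2.ae_form_velocity hφ hs hse he (fun _ ht => (hm ht).1) (A.A a)] with t hv ht
  rw [hv ht, neg_mul]
  rfl

lemma hasLpDerivOn_transportMatrix_swap (σ : CurveSpace d M) (hφ : φ ∈ charts d M) (hs : 0 ≤ s)
    (hse : s ≤ e) (he : e ≤ 1) (hm : MapsTo σ.1 (Icc s e) (φ.source ∩ B.W a)) :
    HasLpDerivOn 2 s e (fun t => A.transportMatrix t s a a σ) fun t =>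
      A.transportMatrix t s a a σ
        * formCoord φ (A.A a) (φ (σ.1 t)) (deriv (fun τ => φ (σ.1 τ)) t) := by
  obtain ⟨hH1, hderiv⟩ := (A.isParallelTransport_parallelTransport σ.2).deriv_snd a s e hs hse he
    (fun _ ht => (hm ht).2) s ⟨le_rfl, hse⟩
  refine (hH1.hasLpDerivOn hse ((ae_restrict_iff' measurableSet_Icc).1 hderiv)).congr_deriv ?_
  filter_upwards [σ.2.ae_form_velocity hφ hs hse he (fun _ ht => (hm ht).1) (A.A a)] with t hv ht
  rw [hv ht]
  rfl

lemma ae_transportedCurvature_eq (hφ : φ ∈ charts d M) (hs : 0 ≤ s) (hse : s ≤ e) (he : e ≤ 1)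
    (hm : MapsTo γ.1 (Icc s e) (φ.source ∩ B.W a)) (X : ∀ t : ℝ, TangentSpace (𝓡 d) (γ.1 t)) :
    ∀ᵐ t, t ∈ Icc s e → A.transportedCurvature γ s e a a X t =
      A.transportMatrix s e a a γ * (A.transportMatrix t s a a γ *
        curvForm (formCoord φ (A.A a)) (φ (γ.1 t)) (fieldCoord φ γ.1 X t)
          (deriv (fun τ => φ (γ.1 τ)) t) * A.transportMatrix s t a a γ) := by
  filter_upwards [γ.2.ae_mfderiv_velocity hφ hs hse he fun _ ht => (hm ht).1] with t hv ht
  have hs' : s ∈ Icc (0 : ℝ) 1 := ⟨hs, hse.trans he⟩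
  have he' : e ∈ Icc (0 : ℝ) 1 := ⟨hs.trans hse, he⟩
  have ht' : t ∈ Icc (0 : ℝ) 1 := ⟨hs.trans ht.1, ht.2.trans he⟩
  rw [A.transportedCurvature_eq s e a a a, A.matrixOf_curvature (hm ht).2,
    A.localCurvature_eq_curvForm hφ (hm ht).1 (hm ht).2,
    ← A.transportMatrix_mul γ ht' hs' he' a a a, mul_assoc, mul_assoc, mul_assoc]
  exact congrArg (fun w => A.transportMatrix s e a a γ * (A.transportMatrix t s a a γ *
    (curvForm (formCoord φ (A.A a)) (φ (γ.1 t)) (fieldCoord φ γ.1 X t) w *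
      A.transportMatrix s t a a γ))) (hv ht)

lemma intervalIntegrable_curvForm (hφ : φ ∈ charts d M) (hs : 0 ≤ s) (hse : s ≤ e) (he : e ≤ 1)
    (hm : MapsTo γ.1 (Icc s e) (φ.source ∩ B.W a))
    {X : ∀ t : ℝ, TangentSpace (𝓡 d) (γ.1 t)} (hX : IsH1Field γ.1 X) :
    IntervalIntegrable (fun t => A.transportMatrix t s a a γ *
      curvForm (formCoord φ (A.A a)) (φ (γ.1 t)) (fieldCoord φ γ.1 X t)
        (deriv (fun τ => φ (γ.1 τ)) t) * A.transportMatrix s t a a γ) volume s e := by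
  have hmφ : MapsTo γ.1 (Icc s e) φ.source := fun t ht => (hm ht).1
  have hcurv := (intervalIntegrable_iff_memLp_one hse).2 <|
    (memLp_curvForm (φ.isOpen_inter_preimage_symm (B.isOpen_W a))
      ((A.smooth a φ hφ).of_le (by simp)) (γ.2.hasLpDerivOn hφ hs hse he hmφ)
      (fun t ht => mem_target_inter_preimage_symm (hm ht).1 (hm ht).2)
      ((hX φ hφ s e hs hse he hmφ).hasLpDerivOn_deriv hse).continuousOn).mono_exponent one_le_two
  exact intervalIntegrable_mul_mul hse
    (A.hasLpDerivOn_transportMatrix_swap γ hφ hs hse he hm).continuousOn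
    (A.hasLpDerivOn_transportMatrix γ hφ hs hse he hm).continuousOn hcurv

lemma hasFirstDerivAt_transportMatrix (hφ : φ ∈ charts d M) (hs : 0 ≤ s) (hse : s < e)
    (he : e ≤ 1) (hm : MapsTo γ.1 (Icc s e) (φ.source ∩ B.W a)) :
    HasFirstDerivAt (A.transportMatrix s e a a) γ fun X =>
      -(A.transportMatrix s e a a γ * ∫ t in s..e, A.transportMatrix t s a a γ *
        curvForm (formCoord φ (A.A a)) (φ (γ.1 t)) (fieldCoord φ γ.1 X t)
          (deriv (fun τ => φ (γ.1 τ)) t) * A.transportMatrix s t a a γ)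
      - A.A a (γ.1 e) (X e) * A.transportMatrix s e a a γ
      + A.transportMatrix s e a a γ * A.A a (γ.1 s) (X s) := by
  intro P _ _ Γ X p₀ hΓ
  obtain rfl := hΓ.base
  have hs' : s ∈ Icc (0 : ℝ) 1 := ⟨hs, hse.le.trans he⟩
  have hO := φ.isOpen_inter_preimage_symm (B.isOpen_W a)
  have hmO : MapsTo (fun t => φ ((Γ p₀).1 t)) (Icc s e) (φ.target ∩ φ.symm ⁻¹' B.W a) :=
    fun t ht => mem_target_inter_preimage_symm (hm ht).1 (hm ht).2
  have hmφ : MapsTo (Γ p₀).1 (Icc s e) φ.source := fun t ht => (hm ht).1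
  have hy := hΓ.hasH1FDerivAt hφ hs hse he hmφ
  have hU : ∀ᶠ p in 𝓝 p₀, HasLpDerivOn 2 s e (fun t => A.transportMatrix s t a a (Γ p)) (fun t =>
      -(formCoord φ (A.A a) (φ ((Γ p).1 t)) (deriv (fun τ => φ ((Γ p).1 τ)) t)
        * A.transportMatrix s t a a (Γ p))) ∧ A.transportMatrix s s a a (Γ p) = 1 := by
    filter_upwards [hΓ.mapsTo φ hφ s e hs hse.le he hmφ, hy.eventually_mapsTo hO hmO] with p hp hpO
    refine ⟨A.hasLpDerivOn_transportMatrix (Γ p) hφ hs hse.le he fun t ht => ⟨hp ht, ?_⟩,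
      A.transportMatrix_self (Γ p) hs' a⟩
    exact φ.left_inv (hp ht) ▸ (hpO ht).2
  have hUW (t) (ht : t ∈ Icc s e) :
      A.transportMatrix s t a a (Γ p₀) * A.transportMatrix t s a a (Γ p₀) = 1 := by
    have ht' : t ∈ Icc (0 : ℝ) 1 := ⟨hs.trans ht.1, ht.2.trans he⟩
    rw [A.transportMatrix_mul (Γ p₀) ht' hs' ht', A.transportMatrix_self _ ht']
  obtain ⟨D, hD, hDeriv⟩ := hy.hasFDerivAt_solution hO hmO ((A.smooth a φ hφ).of_le (by simp))
    (A.hasLpDerivOn_transportMatrix_swap (Γ p₀) hφ hs hse.le he hm)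
    (A.transportMatrix_self (Γ p₀) hs' a) hUW hU
  refine ⟨D, fun p => (hD p).trans ?_, hDeriv⟩
  exact congrArg₂ (fun u v => _ - u * _ + _ * v)
    (formCoord_mfderiv hφ (A.A a) (hmφ ⟨hse.le, le_rfl⟩) _)
    (formCoord_mfderiv hφ (A.A a) (hmφ ⟨le_rfl, hse.le⟩) _)

lemma hasTransportDeriv_of_mapsTo (hφ : φ ∈ charts d M) (hs : 0 ≤ s) (hse : s ≤ e) (he : e ≤ 1)
    (hm : MapsTo γ.1 (Icc s e) (φ.source ∩ B.W a)) : A.HasTransportDeriv γ s e a a := by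
  have hcurv (X) : ∀ᵐ t, t ∈ uIoc s e → _ :=
    (A.ae_transportedCurvature_eq hφ hs hse he hm X).mono fun t h ht =>
      h (Ioc_subset_Icc_self (uIoc_of_le hse ▸ ht))
  refine ⟨fun X hX => ((A.intervalIntegrable_curvForm hφ hs hse he hm hX).const_mul _).congr_ae
    ((ae_restrict_iff' measurableSet_uIoc).2 ((hcurv X).mono fun t h ht => (h ht).symm)), ?_⟩
  obtain rfl | hlt := hse.eq_or_lt
  · have hone : A.transportMatrix s s a a = fun _ : CurveSpace d M => 1 :=
      funext fun σ => A.transportMatrix_self σ ⟨hs, he⟩ a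
    rw [hone]
    exact (hasFirstDerivAt_const 1).congr_deriv fun X _ => by simp
  · refine (A.hasFirstDerivAt_transportMatrix hφ hs hlt he hm).congr_deriv fun X hX => ?_
    rw [intervalIntegral.integral_congr_ae (hcurv X)]
    have hI := intervalIntegral_mul_mul_const (A.intervalIntegrable_curvForm hφ hs hse he hm hX)
      (A.transportMatrix s e a a γ) 1
    simp only [mul_one] at hI
    rw [hI]

end Local

lemma hasTransportDeriv (γ : CurveSpace d M) {c e : ℝ} (hc : 0 ≤ c) (hce : c ≤ e) (he : e ≤ 1)
    {a b : B.ι} (ha : γ.1 c ∈ B.W a) (hb : γ.1 e ∈ B.W b) : A.HasTransportDeriv γ c e a b := by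
  refine interval_induction hce (Q := fun s t => ∀ a b : B.ι, γ.1 s ∈ B.W a → γ.1 t ∈ B.W b →
    A.HasTransportDeriv γ s t a b) ?_ ?_ a b ha hb
  · intro t ht
    obtain ⟨k, hk⟩ := B.cover (γ.1 t)
    obtain ⟨φ, hφ, htφ, hφk⟩ := exists_chart_subset (d := d) (γ.1 t) (B.isOpen_W k) hk
    obtain ⟨U, hU, htU, hUφ⟩ := mem_nhdsWithin.1 <|
      γ.2.1 t ⟨hc.trans ht.1, ht.2.trans he⟩ (φ.open_source.mem_nhds htφ)
    refine ⟨U, hU, htU, fun s r hcs hsr hre hsub a b ha hb => ?_⟩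
    have hs : 0 ≤ s := hc.trans hcs
    have hr : r ≤ 1 := hre.trans he
    have hm : MapsTo γ.1 (Icc s r) (φ.source ∩ B.W k) := fun τ hτ =>
      have hτφ : γ.1 τ ∈ φ.source := hUφ ⟨hsub hτ, hs.trans hτ.1, hτ.2.trans hr⟩
      ⟨hτφ, hφk hτφ⟩
    exact (A.hasTransportDeriv_of_mapsTo hφ hs hsr hr hm).change_trivialization
      ⟨hs, hsr.trans hr⟩ ⟨hs.trans hsr, hr⟩ ⟨(hm ⟨le_rfl, hsr⟩).2, ha⟩
      ⟨hb, (hm ⟨hsr, le_rfl⟩).2⟩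
  · intro s m r hcs hsm hmr hre h₁ h₂ a b ha hb
    obtain ⟨k, hk⟩ := B.cover (γ.1 m)
    exact (h₁ a k ha hk).trans (hc.trans hcs) hsm hmr (hre.trans he) (h₂ k b hk hb)

end Connection

end TransportDerivative

end CurveTransport

end

open CurveTransport in
theorem proposition3p2 {d : ℕ} {M : Type*} [TopologicalSpace M]
    [ChartedSpace (EuclideanSpace ℝ (Fin d)) M] [IsManifold (𝓡 d) ∞ M]
    {N : ℕ} {G : Subgroup (Matrix.specialUnitaryGroup (Fin N) ℂ)}
    {E : M → Type*} [∀ x, AddCommGroup (E x)] [∀ x, Module ℂ (E x)]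
    (B : GBundle d G E) (A : Connection B) :
    -- the parallel transport along every `H¹`-curve exists
    (∀ γ : CurveSpace d M, A.IsParallelTransport γ.1 (A.parallelTransport γ.1)) ∧
    -- its first derivative, in arbitrary trivializations `ψ_a` near `γ(c)`, `ψ_b` near `γ(e)`
    ∀ (γ : CurveSpace d M) (c e : ℝ), 0 ≤ c → c ≤ e → e ≤ 1 →
      ∀ a b : B.ι, γ.1 c ∈ B.W a → γ.1 e ∈ B.W b →
      (∀ X : (∀ t : ℝ, TangentSpace (𝓡 d) (γ.1 t)), IsH1Field γ.1 X →
        IntervalIntegrable (fun t => B.matrixOf b a (A.parallelTransport γ.1 e t ∘ₗ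
          A.curvature (γ.1 t) (X t) (velocity d γ.1 t) ∘ₗ A.parallelTransport γ.1 t c))
          volume c e) ∧
      HasFirstDerivAt (fun σ : CurveSpace d M => B.matrixOf b a (A.parallelTransport σ.1 e c)) γ
        (fun X =>
          -(∫ t in c..e, B.matrixOf b a (A.parallelTransport γ.1 e t ∘ₗ
              A.curvature (γ.1 t) (X t) (velocity d γ.1 t) ∘ₗ A.parallelTransport γ.1 t c))
          - A.A b (γ.1 e) (X e) * B.matrixOf b a (A.parallelTransport γ.1 e c)
          + B.matrixOf b a (A.parallelTransport γ.1 e c) * A.A a (γ.1 c) (X c)) := by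
  refine ⟨fun γ => A.isParallelTransport_parallelTransport γ.2, ?_⟩
  intro γ c e hc hce he a b ha hb
  have h := A.hasTransportDeriv γ hc hce he ha hb
  exact ⟨h.integrable, h.hasDeriv⟩
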